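/- **Theorem 4.1 ($L^2$ stability of the fully discrete CQ–LDG scheme).** Let $\alpha\in(0,1)$, let $k\ge 1$ be an integer and let $\vartheta>0$. Let $\Omega=(0,1)^2$ with points $(x,v)$, let $T>0$, and for integers $L,N\ge1$ put $\tau=T/L$, $t_n=n\tau$, $h=1/N$, $x_i=v_i=ih$ $(0\le i\le N)$ and $I_{i,j}=(x_{i-1},x_i)\times(v_{j-1},v_j)$ $(1\le i,j\le N)$. Let $V_{h,k}$ be the space of functions whose restriction to each $I_{i,j}$ is a polynomial of total degree at most $k$. Let $d^{(\alpha)}_j$ be given by $\sum_{j\ge0}d^{(\alpha)}_j\zeta^j=\big((1-\zeta)/\tau\big)^\alpha$. Write $(\cdot,\cdot)_{I_{i,j}}$ for the $L^2(I_{i,j})$ inner product, $(\cdot,\cdot)_{\partial I_{i,j}}$ for the $L^2(\partial I_{i,j})$ inner product, and $\mathbf n$ for the outward unit normal of $\partial I_{i,j}$. Given a source $f$ with $f(t)\in L^2(\Omega)$ for $t\in[0,T]$ (and $f^n=f(t_n)$) and $G_0\in L^2(\Omega)$, a solution of the scheme consists of $G^n_h\in V_{h,k}$ $(0\le n\le L)$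 and $\mathbf P^n_h=(P^n_{x,h},P^n_{v,h})\in (V_{h,k})^2$ $(1\le n\le L)$ such that, for all $1\le i,j\le N$, all $\mu_h\in V_{h,k}$ and all $\boldsymbol\nu_h\in(V_{h,k})^2$, one has $(G^0_h,\mu_h)_{I_{i,j}}=(G_0,\mu_h)_{I_{i,j}}$ and, for $1\le n\le L$, $$\begin{aligned}&\Big(\sum_{l=0}^{n-1}d^{(\alpha)}_l(G^{n-l}_h-G^0_h),\mu_h\Big)_{I_{i,j}}+(vP^n_{x,h},\mu_h)_{I_{i,j}}-(vP^n_{v,h},\mu_h)_{I_{i,j}}-(\partial_vP^n_{v,h},\mu_h)_{I_{i,j}}\\&\qquad+\int_{x_{i-1}}^{x_i}(P^n_{v,h}-\hat P^n_{v,h})\mu_h\Big|_{v=v_{j-1}}^{v=v_j}dx=(f^n,\mu_h)_{I_{i,j}}+(G^n_h,\mu_h)_{I_{i,j}},\\&(\mathbf P^n_h,\boldsymbol\nu_h)_{I_{i,j}}=(\nabla G^n_h,\boldsymbol\nu_h)_{I_{i,j}}-(G^n_h-\hat G^n_h,\mathbf n\cdot\boldsymbol\nu_h)_{\partial I_{i,j}},\end{aligned}$$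 where un-hatted boundary values are traces from inside $I_{i,j}$ and the numerical fluxes are $$\hat G^n_h(x_i,v)=G^n_h(x_i^-,v)\ (1\le i\le N),\qquad \hat G^n_h(x_0,v)=0,$$ $$\hat G^n_h(x,v_j)=G^n_h(x,v_j^+)\ (1\le j\le N-1),\qquad \hat G^n_h(x,v_0)=\hat G^n_h(x,v_N)=0,$$ $$\hat P^n_{v,h}(x,v_j)=P^n_{v,h}(x,v_j^-)\ (1\le j\le N),\qquad \hat P^n_{v,h}(x,v_0)=P^n_{v,h}(x,v_0^+)+\frac{\vartheta\, G^n_h(x,v_0^+)}{h}.$$ Then the scheme is $L^2$ stable for all sufficiently small time steps, uniformly in the mesh: there is $\tau_0>0$ depending only on $\alpha,k,\vartheta$, and for every $T>0$ there is $C>0$ depending only on $\alpha,k,\vartheta,T$, such that for all $N,L\ge1$ with $\tau=T/L\le\tau_0$, for any two solutions $\{G^n_h,\mathbf P^n_h\}$ and $\{\bar G^n_h,\bar{\mathbf P}^n_h\}$ of the scheme with the same source $f$ and initial data $G_0,\bar G_0\in L^2(\Omega)$ respectively, $$\|G^n_h-\bar G^n_h\|_{L^2(\Omega)}\le C\,\|G^0_h-\bar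 G^0_h\|_{L^2(\Omega)}\qquad\text{for all }0\le n\le L.$$ -/

import Mathlib

open MeasureTheory Set

noncomputable section

namespace KleinKramersLDG

/-! ### Backward Euler convolution quadrature -/

/-- The weight `d_j^{(α)}` of the backward Euler convolution quadrature with step size `τ`:
the coefficient of `ζ ^ j` in `((1 - ζ) / τ) ^ α` (see `hasSum_cqWeight`). -/
def cqWeight (α τ : ℝ) (j : ℕ) : ℝ :=
  τ ^ (-α) * ((-1) ^ j * Ring.choose α j)

/-- The weights are generated by `((1 - ζ) / τ) ^ α`. -/
theorem hasSum_cqWeight (α : ℝ) {τ : ℝ} (hτ : 0 < τ) {ζ : ℝ} (hζ : |ζ| < 1) :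
    HasSum (fun j : ℕ => cqWeight α τ j * ζ ^ j) (((1 - ζ) / τ) ^ α) := by
  have h := (Real.one_add_rpow_hasFPowerSeriesOnBall_zero (a := α)).hasSum (y := -ζ)
    (by simpa [← ofReal_norm] using hζ)
  have h2 := h.mul_left (τ ^ (-α))
  have h1 : 0 ≤ 1 - ζ := by linarith [(abs_lt.mp hζ).2]
  have e1 : (fun j : ℕ => cqWeight α τ j * ζ ^ j) =
      fun j => τ ^ (-α) * (binomialSeries ℝ α j) (fun _ => -ζ) := by
    funext j
    simp only [cqWeight, binomialSeries_apply, smul_eq_mul, List.prod_ofFn, Finset.prod_const,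
      Finset.card_univ, Fintype.card_fin]
    rw [neg_pow]
    ring
  have e2 : ((1 - ζ) / τ) ^ α = τ ^ (-α) * (1 + (0 + -ζ)) ^ α := by
    rw [Real.div_rpow h1 hτ.le, Real.rpow_neg hτ.le, zero_add, ← sub_eq_add_neg, div_eq_inv_mul]
  rw [e1, e2]
  exact h2

/-! ### The mesh and the discontinuous finite element space -/

/-- The mesh size `h = 1 / N`. -/
def meshSize (N : ℕ) : ℝ := 1 / N

/-- The mesh points `x_m = v_m = m h`, `m = 0, …, N`. -/
def node (N m : ℕ) : ℝ := m * meshSize N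

/-- The element `(x_i, x_{i+1}) × (v_j, v_{j+1})`; elements are numbered from `0` to `N - 1` in
each direction. A point of the plane is a pair `(x, v)`. -/
def cell (N : ℕ) (i j : Fin N) : Set (ℝ × ℝ) :=
  Ioo (node N i) (node N (i + 1)) ×ˢ Ioo (node N j) (node N (j + 1))

/-- The domain `Ω = (0, 1) × (0, 1)`. -/
def domain : Set (ℝ × ℝ) := Ioo 0 1 ×ˢ Ioo 0 1

/-- Polynomials in the two variables `(x, v)` (variable `0` is `x`, variable `1` is `v`). -/
abbrev Poly2 : Type := MvPolynomial (Fin 2) ℝ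

/-- Value of a polynomial at `(x, v)`. -/
def val (p : Poly2) (x v : ℝ) : ℝ := MvPolynomial.eval ![x, v] p

/-- `∂p/∂x`. -/
def dx (p : Poly2) : Poly2 := MvPolynomial.pderiv 0 p

/-- `∂p/∂v`. -/
def dv (p : Poly2) : Poly2 := MvPolynomial.pderiv 1 p

/-- `ℙ_k`: the polynomials of (total) degree at most `k`. -/
abbrev PolyLE (k : ℕ) : Type := MvPolynomial.restrictTotalDegree (Fin 2) ℝ k

/-- The discontinuous finite element space `V_{h,k}`: on every element an independent polynomial of
degree at most `k`. The one-sided limits of an element function at a mesh line are the values there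
of the polynomial of the adjacent element. -/
abbrev FESpace (N k : ℕ) : Type := Fin N → Fin N → PolyLE k

/-- An element of `V_{h,k}` as a function on the plane: on each (open) element it is the polynomial
of that element; it is set to zero elsewhere. -/
def toFun {N k : ℕ} (u : FESpace N k) (z : ℝ × ℝ) : ℝ :=
  ∑ i : Fin N, ∑ j : Fin N, (cell N i j).indicator (fun w => val (u i j) w.1 w.2) z

/-! ### Numerical fluxes -/

section Fluxes

variable {N k : ℕ}

/-- The flux `Ĝ(x_m, v)` on the vertical mesh line `x = x_m`, for `v` in the `j`-th interval:
`0` for `m = 0` (boundary condition) and the left trace `G(x_m^-, v)` for `m = 1, …, N`. -/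
def fluxGx (G : FESpace N k) (m : Fin (N + 1)) (j : Fin N) (v : ℝ) : ℝ :=
  if hm : m = 0 then 0 else val (G (m.pred hm) j) (node N m) v

/-- The flux `Ĝ(x, v_m)` on the horizontal mesh line `v = v_m`, for `x` in the `i`-th interval:
`0` for `m = 0` and `m = N`, and the upper trace `G(x, v_m^+)` for `m = 1, …, N - 1`. -/
def fluxGv (G : FESpace N k) (i : Fin N) (m : Fin (N + 1)) (x : ℝ) : ℝ :=
  if m = 0 then 0
  else if hm : m = Fin.last N then 0
  else val (G i (m.castPred hm)) x (node N m)

/-- The flux `P̂_v(x, v_m)` on the horizontal mesh line `v = v_m`, for `x` in the `i`-th interval: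
the lower trace `P_v(x, v_m^-)` for `m = 1, …, N`, and the penalized upper trace
`P_v(x, v_0^+) + ϑ G(x, v_0^+) / h` for `m = 0`. -/
def fluxPv [NeZero N] (ϑ : ℝ) (G Pv : FESpace N k) (i : Fin N) (m : Fin (N + 1)) (x : ℝ) : ℝ :=
  if hm : m = 0 then
    val (Pv i 0) x (node N 0) + ϑ * val (G i 0) x (node N 0) / meshSize N
  else val (Pv i (m.pred hm)) x (node N m)

end Fluxes

/-! ### The scheme -/

/-- The inner product `(f, g)` on the element `(i, j)`. -/
def cellInner (N : ℕ) (i j : Fin N) (f g : ℝ → ℝ → ℝ) : ℝ :=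
  ∫ z in cell N i j, f z.1 z.2 * g z.1 z.2

section Scheme

variable {N k : ℕ}

/-- `∫_{x_i}^{x_{i+1}} (P_v - P̂_v) μ |_{v = v_j}^{v = v_{j+1}} dx` on the element `(i, j)`. -/
def jumpPv [NeZero N] (ϑ : ℝ) (G Pv μ : FESpace N k) (i j : Fin N) : ℝ :=
  ∫ x in (node N i)..(node N (i + 1)),
    ((val (Pv i j) x (node N (j + 1)) - fluxPv ϑ G Pv i j.succ x) * val (μ i j) x (node N (j + 1))
      - (val (Pv i j) x (node N j) - fluxPv ϑ G Pv i j.castSucc x) * val (μ i j) x (node N j))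

/-- `(G - Ĝ, 𝐧 · 𝛎)` on the boundary of the element `(i, j)`, with `𝛎 = (νx, νv)` and `𝐧` the outward
unit normal: the first integral collects the right and left edges, the second one the upper and
lower edges. -/
def jumpG (G νx νv : FESpace N k) (i j : Fin N) : ℝ :=
  (∫ v in (node N j)..(node N (j + 1)),
    ((val (G i j) (node N (i + 1)) v - fluxGx G i.succ j v) * val (νx i j) (node N (i + 1)) v
      - (val (G i j) (node N i) v - fluxGx G i.castSucc j v) * val (νx i j) (node N i) v))
  + ∫ x in (node N i)..(node N (i + 1)),
    ((val (G i j) x (node N (j + 1)) - fluxGv G i j.succ x) * val (νv i j) x (node N (j + 1))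
      - (val (G i j) x (node N j) - fluxGv G i j.castSucc x) * val (νv i j) x (node N j))

/-- `(G^n, P_x^n, P_v^n)`, `n = 0, …, L`, solves the fully discrete CQ–LDG scheme with step size
`τ`, penalty parameter `ϑ`, source term `f` (so `f^n = f(n τ)`) and initial value `G₀`. The
boundary conditions enter through the numerical fluxes. (`Px 0`, `Pv 0` and indices larger
than `L` play no role.) -/
structure IsSolution [NeZero N] (α τ ϑ : ℝ) (L : ℕ) (f : ℝ → ℝ × ℝ → ℝ) (G₀ : ℝ × ℝ → ℝ)
    (G Px Pv : ℕ → FESpace N k) : Prop where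
  evolution : ∀ n : ℕ, 1 ≤ n → n ≤ L → ∀ (μ : FESpace N k) (i j : Fin N),
    cellInner N i j
        (fun x v => ∑ l ∈ Finset.range n,
          cqWeight α τ l * (val (G (n - l) i j) x v - val (G 0 i j) x v)) (val (μ i j))
      + cellInner N i j (fun x v => v * val (Px n i j) x v) (val (μ i j))
      - cellInner N i j (fun x v => v * val (Pv n i j) x v) (val (μ i j))
      - cellInner N i j (val (dv (Pv n i j))) (val (μ i j))
      + jumpPv ϑ (G n) (Pv n) μ i j
    = cellInner N i j (fun x v => f (n * τ) (x, v)) (val (μ i j))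
      + cellInner N i j (val (G n i j)) (val (μ i j))
  gradient : ∀ n : ℕ, 1 ≤ n → n ≤ L → ∀ (νx νv : FESpace N k) (i j : Fin N),
    cellInner N i j (val (Px n i j)) (val (νx i j))
      + cellInner N i j (val (Pv n i j)) (val (νv i j))
    = cellInner N i j (val (dx (G n i j))) (val (νx i j))
      + cellInner N i j (val (dv (G n i j))) (val (νv i j))
      - jumpG (G n) νx νv i j
  initial : ∀ (μ : FESpace N k) (i j : Fin N),
    cellInner N i j (val (G 0 i j)) (val (μ i j))
      = cellInner N i j (fun x v => G₀ (x, v)) (val (μ i j))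

end Scheme

/-- The `L²(Ω)` norm. -/
def normL2 (u : ℝ × ℝ → ℝ) : ENNReal := eLpNorm u 2 (volume.restrict domain)

/-- Membership in `L²(Ω)`. -/
def InL2 (u : ℝ × ℝ → ℝ) : Prop := MemLp u 2 (volume.restrict domain)

end KleinKramersLDG

end

/-!
The scheme is linear, so that the difference `E = G - G'` of two solutions with the same source
solves the scheme with zero source, and stability is an energy estimate for `E` with a constant that
does not see the mesh. At each time level the evolution equation is tested with `E` and the gradient
equation twice, and the results are summed over all elements.

* In the direction `v`, testing the gradient with `P_v` and integrating by parts, the alternating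
  fluxes cancel at the interior mesh lines, and what is left is `‖P_v‖²` plus the nonnegative
  penalty (`sum_cellInt_mul_self_le_diffusion`). This absorbs `(v P_v, E)`.
* In the direction `x`, the term `(v P_x, E)` would call for the test function `v E`, which has
  degree `k + 1`; its elementwise `L²` projection is used instead. With `v E` itself upwinding gives
  a nonnegative quantity. The projection error is invisible in the volume term, because `∂_x E` has
  degree at most `k`; on the edges it meets the jumps of `E`. As `v` varies by `h` on an element,
  this error is of size `h ‖E‖` (`cellInt_projection_error_le`), and the two powers `h ^ (-1/2)` lost
  in the trace inequality are compensated (`transport_lower_bound`).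

Hence `2 ∑_{l < n} d_l (E^{n-l} - E^0, E^n) ≤ 2 (K + 1) ‖E^n‖²` with `K` depending only on `k`
(`exists_spatial_lower_bound`). The weights satisfy `d_l ≤ 0` for `l ≥ 1` and have nonnegative
partial sums, so that the left-hand side dominates the discrete fractional derivative of `‖E^n‖²`
(`sum_cqWeight_mul_sqNorm_le`). A discrete fractional Gronwall inequality (`cq_gronwall`) with the
explicit supersolution `1 + (1 - λ τ) ^ (-n)`, where `λ ^ α = 4 (K + 1)` and `λ τ ≤ 1 / 2`, then
bounds `‖E^n‖²` by `(1 + exp (2 λ T)) ‖E^0‖²`.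
-/

open MeasureTheory Set

noncomputable section

namespace KleinKramersLDG

/-! ### Convolution quadrature weights and a discrete fractional Gronwall inequality -/

theorem succ_mul_choose_succ (α : ℝ) (j : ℕ) :
    ((j : ℝ) + 1) * Ring.choose α (j + 1) = (α - j) * Ring.choose α j := by
  have h0 := Ring.descPochhammer_eq_factorial_smul_choose α j
  have h1 := Ring.descPochhammer_eq_factorial_smul_choose α (j + 1)
  rw [descPochhammer_succ_right, Polynomial.smeval_mul, h0] at h1
  simp only [Polynomial.smeval_sub, Polynomial.smeval_X, Polynomial.smeval_natCast, pow_one,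
    nsmul_eq_mul, pow_zero, mul_one, Nat.factorial_succ] at h1
  have hf : (j.factorial : ℝ) ≠ 0 := by positivity
  push_cast at h1
  apply mul_left_cancel₀ hf
  linarith

/-- The weights satisfy the two-term recursion of the binomial coefficients. -/
theorem cqWeight_succ (α τ : ℝ) (j : ℕ) :
    ((j : ℝ) + 1) * cqWeight α τ (j + 1) = (j - α) * cqWeight α τ j := by
  have h := succ_mul_choose_succ α j
  unfold cqWeight
  rw [pow_succ]
  linear_combination (-(τ ^ (-α) * (-1) ^ j)) * h

theorem cqWeight_zero (α τ : ℝ) : cqWeight α τ 0 = τ ^ (-α) := by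
  simp [cqWeight]

theorem cqWeight_succ_nonpos {α τ : ℝ} (hα : α ∈ Ioo (0 : ℝ) 1) (hτ : 0 < τ) (j : ℕ) :
    cqWeight α τ (j + 1) ≤ 0 := by
  induction j with
  | zero =>
    have h := cqWeight_succ α τ 0
    have h0 : 0 < cqWeight α τ 0 := by rw [cqWeight_zero]; positivity
    simp only [Nat.cast_zero, zero_add, one_mul, zero_sub] at h
    rw [zero_add, h]
    nlinarith [hα.1]
  | succ j ih =>
    have h := cqWeight_succ α τ (j + 1)
    push_cast at h
    have h1 : ((j : ℝ) + 1 - α) * cqWeight α τ (j + 1) ≤ 0 :=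
      mul_nonpos_of_nonneg_of_nonpos (by linarith [hα.2, (Nat.cast_nonneg j : (0 : ℝ) ≤ j)]) ih
    rw [← h] at h1
    exact nonpos_of_mul_nonpos_right h1 (by positivity)

/-- The partial sums of the weights telescope by the recursion `cqWeight_succ`. -/
theorem mul_sum_cqWeight (α τ : ℝ) (n : ℕ) :
    α * ∑ l ∈ Finset.range n, cqWeight α τ l = -(n * cqWeight α τ n) := by
  induction n with
  | zero => simp
  | succ n ih =>
    rw [Finset.sum_range_succ, mul_add, ih]
    push_cast
    linarith [cqWeight_succ α τ n]

theorem sum_cqWeight_nonneg {α τ : ℝ} (hα : α ∈ Ioo (0 : ℝ) 1) (hτ : 0 < τ) (n : ℕ) :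
    0 ≤ ∑ l ∈ Finset.range n, cqWeight α τ l := by
  cases n with
  | zero => simp
  | succ n =>
    have h := mul_sum_cqWeight α τ (n + 1)
    have h1 := cqWeight_succ_nonpos hα hτ n
    have h2 : 0 ≤ α * ∑ l ∈ Finset.range (n + 1), cqWeight α τ l := by
      rw [h]
      have : (0 : ℝ) ≤ ((n + 1 : ℕ) : ℝ) := by positivity
      nlinarith
    exact nonneg_of_mul_nonneg_right h2 hα.1

/-- Since the omitted weights are nonpositive, the partial sums of the generating series dominate
its sum. -/
theorem rpow_le_sum_cqWeight {α τ lam : ℝ} (hα : α ∈ Ioo (0 : ℝ) 1) (hτ : 0 < τ) (hlam : 0 < lam)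
    (hs : lam * τ < 1) {n : ℕ} (hn : 1 ≤ n) :
    lam ^ α ≤ ∑ l ∈ Finset.range n, cqWeight α τ l * (1 - lam * τ) ^ l := by
  have hp : 0 < lam * τ := mul_pos hlam hτ
  have h := hasSum_cqWeight α hτ (ζ := 1 - lam * τ) (by rw [abs_lt]; constructor <;> linarith)
  have e : (1 - (1 - lam * τ)) / τ = lam := by field_simp; ring
  rw [e] at h
  have h2 := sum_le_hasSum (Finset.range n) (fun l hl => ?_) h.neg
  · rw [Finset.sum_neg_distrib] at h2
    linarith
  · cases l with
    | zero => exact absurd (Finset.mem_range.mpr hn) hl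
    | succ l =>
      have := mul_nonpos_of_nonpos_of_nonneg (cqWeight_succ_nonpos hα hτ l)
        (pow_nonneg (by linarith : 0 ≤ 1 - lam * τ) (l + 1))
      linarith

/-- A discrete fractional Gronwall inequality. With `ζ = 1 - λ τ`, the sequence equal to `ζ ^ (-n)`
for `n ≥ 1` and to `0` for `n = 0` has discrete fractional derivative at least
`λ ^ α ζ ^ (-n) = 2 K ζ ^ (-n) ≥ K (1 + ζ ^ (-n))`, so that `1 + ζ ^ (-n)` is a supersolution. -/
theorem cq_gronwall {α τ lam K : ℝ} (hα : α ∈ Ioo (0 : ℝ) 1) (hτ : 0 < τ) (hlam : 0 < lam)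
    (hK : lam ^ α = 2 * K) (hs : lam * τ ≤ 1 / 2) {L : ℕ} {A : ℕ → ℝ} (hA : 0 ≤ A 0)
    (h : ∀ n, 1 ≤ n → n ≤ L →
      ∑ l ∈ Finset.range n, cqWeight α τ l * (A (n - l) - A 0) ≤ K * A n) :
    ∀ n, n ≤ L → A n ≤ (1 + ((1 - lam * τ)⁻¹) ^ n) * A 0 := by
  have hp : 0 < lam * τ := mul_pos hlam hτ
  have hζ : 0 < 1 - lam * τ := by linarith
  set r : ℝ := (1 - lam * τ)⁻¹ with hr
  have hr0 : 0 < r := inv_pos.mpr hζ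
  have hr1 : 1 ≤ r := (one_le_inv₀ hζ).mpr (by linarith)
  have hK0 : 0 < K := by
    have := Real.rpow_pos_of_pos hlam α
    linarith
  -- `τ ^ (-α)` exceeds `λ ^ α`, hence also `K`
  have hd : K < cqWeight α τ 0 := by
    have h1 : (lam * τ) ^ α ≤ 1 := Real.rpow_le_one hp.le (by linarith) hα.1.le
    rw [Real.mul_rpow hlam.le hτ.le, hK] at h1
    rw [cqWeight_zero, Real.rpow_neg hτ.le]
    have h2 := Real.rpow_pos_of_pos hτ α
    rw [lt_inv_comm₀ hK0 h2, ← one_div, lt_div_iff₀ hK0]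
    nlinarith
  intro n
  induction n using Nat.strong_induction_on with
  | _ n ih =>
  intro hn
  rcases Nat.eq_zero_or_pos n with rfl | hn1
  · simp only [pow_zero]; linarith
  set D : ℕ → ℝ := fun m => A m - (1 + r ^ m) * A 0 with hD
  have h1 := h n hn1 hn
  have e1 : ∑ l ∈ Finset.range n, cqWeight α τ l * (A (n - l) - A 0)
      = ∑ l ∈ Finset.range n, cqWeight α τ l * D (n - l)
        + r ^ n * A 0 * ∑ l ∈ Finset.range n, cqWeight α τ l * (1 - lam * τ) ^ l := by
    rw [Finset.mul_sum, ← Finset.sum_add_distrib]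
    refine Finset.sum_congr rfl fun l hl => ?_
    have hl' : l ≤ n := (Finset.mem_range.mp hl).le
    have e2 : r ^ n * (1 - lam * τ) ^ l = r ^ (n - l) := by
      rw [← Nat.sub_add_cancel hl', pow_add, mul_assoc, ← mul_pow, Nat.sub_add_cancel hl', hr,
        inv_mul_cancel₀ hζ.ne', one_pow, mul_one]
    simp only [hD]
    linear_combination (-(cqWeight α τ l) * A 0) * e2
  have h2 : cqWeight α τ 0 * D n ≤ ∑ l ∈ Finset.range n, cqWeight α τ l * D (n - l) := by
    obtain ⟨m, rfl⟩ : ∃ m, n = m + 1 := ⟨n - 1, by omega⟩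
    rw [Finset.sum_range_succ', Nat.sub_zero]
    refine le_add_of_nonneg_left (Finset.sum_nonneg fun l hl => ?_)
    have hl' := Finset.mem_range.mp hl
    refine mul_nonneg_of_nonpos_of_nonpos (cqWeight_succ_nonpos hα hτ l) ?_
    have := ih (m + 1 - (l + 1)) (by omega) (by omega)
    simp only [hD]
    linarith
  have h3 := mul_le_mul_of_nonneg_left
    (rpow_le_sum_cqWeight hα hτ hlam (by linarith) hn1) (mul_nonneg (pow_nonneg hr0.le n) hA)
  rw [hK] at h3
  have h4 : K * A 0 ≤ K * (r ^ n * A 0) :=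
    mul_le_mul_of_nonneg_left (le_mul_of_one_le_left hA (one_le_pow₀ hr1)) hK0.le
  have h5 : (cqWeight α τ 0 - K) * D n ≤ 0 := by
    have : A n = D n + (1 + r ^ n) * A 0 := by simp only [hD]; ring
    rw [this] at h1
    linarith
  have h6 := nonpos_of_mul_nonpos_right h5 (sub_pos.mpr hd)
  simp only [hD] at h6
  linarith

theorem inv_one_sub_pow_le_exp {y : ℝ} (hy : 0 ≤ y) (hy2 : y ≤ 1 / 2) (n : ℕ) :
    ((1 - y)⁻¹) ^ n ≤ Real.exp (2 * (n * y)) := by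
  have h1 : (1 - y)⁻¹ ≤ Real.exp (2 * y) := by
    rw [inv_le_iff_one_le_mul₀ (by linarith)]
    nlinarith [Real.add_one_le_exp (2 * y)]
  calc ((1 - y)⁻¹) ^ n ≤ Real.exp (2 * y) ^ n :=
        pow_le_pow_left₀ (inv_nonneg.mpr (by linarith)) h1 n
    _ = Real.exp (2 * (n * y)) := by rw [← Real.exp_nat_mul]; ring_nf

/-! ### Representation of functionals and the trace inequality in one variable -/

/-- Riesz representation on a finite-dimensional subspace `S` of an algebra, with respect to the
form `(p, q) ↦ J (p q)`, assumed positive definite on `S`. -/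
theorem exists_mem_forall_apply_mul_eq {R : Type*} [CommRing R] [Algebra ℝ R] (S : Submodule ℝ R)
    [FiniteDimensional ℝ S] (J : R →ₗ[ℝ] ℝ) (hpos : ∀ p ∈ S, 0 ≤ J (p * p))
    (hdef : ∀ p ∈ S, J (p * p) = 0 → p = 0) (φ : R →ₗ[ℝ] ℝ) :
    ∃ w ∈ S, ∀ q ∈ S, J (w * q) = φ q := by
  let B : LinearMap.BilinForm ℝ S := ((LinearMap.mul ℝ R).compr₂ J).domRestrict₁₂ S S
  have hB : ∀ p q : S, B p q = J ((p : R) * q) := fun p q => rfl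
  have hsymm : LinearMap.IsSymm B := ⟨fun p q => by simp only [hB, mul_comm, RingHom.id_apply]⟩
  have hnd : B.Nondegenerate := by
    refine (LinearMap.BilinForm.nondegenerate_iff B (fun p => hpos p p.2) hsymm).mpr fun p => ?_
    refine ⟨fun h => Subtype.ext (hdef p p.2 h), ?_⟩
    rintro rfl
    simp
  let w : S := (B.toDual hnd).symm (φ.domRestrict S)
  refine ⟨w, w.2, fun q hq => ?_⟩
  exact LinearMap.BilinForm.apply_toDual_symm_apply (hB := hnd) (φ.domRestrict S) ⟨q, hq⟩

/-- On a finite-dimensional space every functional is bounded in the norm `J (q * q)`. -/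
theorem exists_sq_le_mul_apply_mul_self {R : Type*} [CommRing R] [Algebra ℝ R]
    (S : Submodule ℝ R) [FiniteDimensional ℝ S] (J : R →ₗ[ℝ] ℝ)
    (hpos : ∀ p ∈ S, 0 ≤ J (p * p)) (hdef : ∀ p ∈ S, J (p * p) = 0 → p = 0) (φ : R →ₗ[ℝ] ℝ) :
    ∃ C : ℝ, 0 < C ∧ ∀ q ∈ S, φ q ^ 2 ≤ C * J (q * q) := by
  obtain ⟨w, hw, hwφ⟩ := exists_mem_forall_apply_mul_eq S J hpos hdef φ
  refine ⟨J (w * w) + 1, by linarith [hpos w hw], fun q hq => ?_⟩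
  set c := J (w * w) + 1 with hc
  have hc0 : 0 < c := by linarith [hpos w hw]
  have h := hpos (c • q - φ q • w) (S.sub_mem (S.smul_mem _ hq) (S.smul_mem _ hw))
  have e : (c • q - φ q • w) * (c • q - φ q • w)
      = (c ^ 2) • (q * q) - (2 * c * φ q) • (w * q) + (φ q ^ 2) • (w * w) := by
    simp only [Algebra.smul_def, map_mul, map_pow, map_ofNat]
    ring
  rw [e, map_add, map_sub, map_smul, map_smul, map_smul, hwφ q hq, smul_eq_mul, smul_eq_mul,
    smul_eq_mul, show J (w * w) = c - 1 by rw [hc]; ring] at h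
  have h2 : 0 ≤ c * (c * J (q * q) - φ q ^ 2) := by nlinarith [sq_nonneg (φ q)]
  linarith [nonneg_of_mul_nonneg_right h2 hc0]

/-- The integral over `[0, 1]` as a functional on polynomials. -/
def unitIntegral : Polynomial ℝ →ₗ[ℝ] ℝ where
  toFun q := ∫ x in (0 : ℝ)..1, q.eval x
  map_add' p q := by
    simp only [Polynomial.eval_add]
    exact intervalIntegral.integral_add (p.continuous.intervalIntegrable _ _)
      (q.continuous.intervalIntegrable _ _)
  map_smul' c q := by
    simp only [Polynomial.eval_smul, smul_eq_mul, RingHom.id_apply]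
    exact intervalIntegral.integral_const_mul _ _

theorem unitIntegral_mul_self_nonneg (q : Polynomial ℝ) : 0 ≤ unitIntegral (q * q) :=
  intervalIntegral.integral_nonneg zero_le_one fun x _ => by
    rw [Polynomial.eval_mul]; exact mul_self_nonneg _

theorem eq_zero_of_unitIntegral_mul_self (q : Polynomial ℝ) (h : unitIntegral (q * q) = 0) :
    q = 0 := by
  have hc : Continuous fun x : ℝ => (q * q).eval x := (q * q).continuous
  have h' : ∫ x in (0 : ℝ)..1, (q * q).eval x = 0 := h
  rw [intervalIntegral.integral_of_le zero_le_one, integral_Ioc_eq_integral_Ioo,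
    setIntegral_eq_zero_iff_of_nonneg_ae
      (Filter.Eventually.of_forall fun x => by
        simp only [Polynomial.eval_mul]; exact mul_self_nonneg _)
      ((hc.integrableOn_Icc (a := 0) (b := 1)).mono_set Ioo_subset_Icc_self)] at h'
  have h2 := Measure.eqOn_open_of_ae_eq h' isOpen_Ioo hc.continuousOn continuousOn_const
  refine Polynomial.eq_zero_of_infinite_isRoot q
    ((Ioo_infinite (zero_lt_one (α := ℝ))).mono fun x hx => ?_)
  have := h2 hx
  simpa using this

/-- The trace inequality: point values of polynomials of degree at most `m` at the end points of an
interval of length `h` are bounded by `h ^ (-1/2)` times the `L²` norm. -/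
theorem exists_trace_const (m : ℕ) : ∃ C : ℝ, 0 < C ∧ ∀ q : Polynomial ℝ, q.natDegree ≤ m →
    ∀ a h : ℝ, 0 < h →
      h * q.eval a ^ 2 ≤ C * ∫ x in a..(a + h), q.eval x ^ 2 ∧
      h * q.eval (a + h) ^ 2 ≤ C * ∫ x in a..(a + h), q.eval x ^ 2 := by
  have key : ∀ y : ℝ, ∃ C : ℝ, 0 < C ∧ ∀ q ∈ Polynomial.degreeLT ℝ (m + 1),
      q.eval y ^ 2 ≤ C * unitIntegral (q * q) := fun y =>
    exists_sq_le_mul_apply_mul_self _ unitIntegral (fun p _ => unitIntegral_mul_self_nonneg p)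
      (fun p _ => eq_zero_of_unitIntegral_mul_self p) (Polynomial.leval y)
  obtain ⟨C₀, hC₀, h₀⟩ := key 0
  obtain ⟨C₁, hC₁, h₁⟩ := key 1
  refine ⟨C₀ + C₁, by positivity, fun q hq a h hh => ?_⟩
  -- rescaling to the unit interval
  set p : Polynomial ℝ := q.comp (Polynomial.C h * Polynomial.X + Polynomial.C a) with hp
  have hpv : ∀ x, p.eval x = q.eval (h * x + a) := fun x => by simp [hp]
  have hpm : p ∈ Polynomial.degreeLT ℝ (m + 1) := by
    rw [Polynomial.mem_degreeLT]
    have h1 : p.natDegree ≤ m := by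
      refine Polynomial.natDegree_comp_le.trans ?_
      calc q.natDegree * _ ≤ m * 1 := Nat.mul_le_mul hq Polynomial.natDegree_linear_le
        _ = m := mul_one m
    exact lt_of_le_of_lt (Polynomial.degree_le_of_natDegree_le h1) (by exact_mod_cast m.lt_succ_self)
  have hi : unitIntegral (p * p) = h⁻¹ * ∫ x in a..(a + h), q.eval x ^ 2 := by
    have e : unitIntegral (p * p) = ∫ x in (0 : ℝ)..1, (fun y => q.eval y ^ 2) (h * x + a) := by
      refine intervalIntegral.integral_congr fun x _ => ?_
      simp only [Polynomial.eval_mul, hpv, sq]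
    rw [e, intervalIntegral.integral_comp_mul_add (fun y => q.eval y ^ 2) hh.ne' a]
    simp [add_comm]
  have hn := unitIntegral_mul_self_nonneg p
  have e0 := h₀ p hpm
  have e1 := h₁ p hpm
  rw [hpv, mul_zero, zero_add] at e0
  rw [hpv, mul_one, add_comm] at e1
  have hI : ∫ x in a..(a + h), q.eval x ^ 2 = h * unitIntegral (p * p) := by
    rw [hi]; field_simp
  rw [hI]
  constructor <;> nlinarith [mul_nonneg hC₀.le hn, mul_nonneg hC₁.le hn]

/-! ### Integrals of polynomials over elements and edges -/

theorem val_add (p q : Poly2) (x v : ℝ) : val (p + q) x v = val p x v + val q x v := map_add _ _ _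

theorem val_sub (p q : Poly2) (x v : ℝ) : val (p - q) x v = val p x v - val q x v := map_sub _ _ _

theorem val_mul (p q : Poly2) (x v : ℝ) : val (p * q) x v = val p x v * val q x v := map_mul _ _ _

theorem val_smul (c : ℝ) (p : Poly2) (x v : ℝ) : val (c • p) x v = c * val p x v := by
  simp [val, MvPolynomial.smul_eval]

theorem val_zero (x v : ℝ) : val 0 x v = 0 := map_zero _

theorem val_C (c x v : ℝ) : val (MvPolynomial.C c) x v = c := by simp [val]

theorem val_X_one (x v : ℝ) : val (MvPolynomial.X 1) x v = v := by simp [val]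

theorem continuous_val (p : Poly2) : Continuous fun z : ℝ × ℝ => val p z.1 z.2 := by
  refine (MvPolynomial.continuous_eval p).comp ?_
  refine continuous_pi fun i => ?_
  fin_cases i
  · exact continuous_fst
  · exact continuous_snd

theorem continuous_val_left (p : Poly2) (v : ℝ) : Continuous fun x => val p x v :=
  Continuous.comp (g := fun z : ℝ × ℝ => val p z.1 z.2) (f := fun x : ℝ => (x, v))
    (continuous_val p) (by fun_prop)

theorem continuous_val_right (p : Poly2) (x : ℝ) : Continuous fun v => val p x v :=
  Continuous.comp (g := fun z : ℝ × ℝ => val p z.1 z.2) (f := fun v : ℝ => (x, v))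
    (continuous_val p) (by fun_prop)

theorem hasDerivAt_val_left (p : Poly2) (x v : ℝ) :
    HasDerivAt (fun y => val p y v) (val (dx p) x v) x := by
  induction p using MvPolynomial.induction_on with
  | C a => simpa [val, dx] using hasDerivAt_const x a
  | add p q hp hq =>
    simp only [val_add, dx, map_add] at *
    exact hp.add hq
  | mul_X p i hp =>
    have hX : HasDerivAt (fun y => val (MvPolynomial.X i) y v)
        (val (MvPolynomial.pderiv 0 (MvPolynomial.X i)) x v) x := by
      fin_cases i
      · simpa [val, MvPolynomial.pderiv_X] using hasDerivAt_id' x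
      · simpa [val, MvPolynomial.pderiv_X] using hasDerivAt_const x v
    have h := hp.mul hX
    simp only [dx, Derivation.leibniz, val_add, smul_eq_mul, val_mul] at *
    exact h.congr_deriv (by ring)

theorem hasDerivAt_val_right (p : Poly2) (x v : ℝ) :
    HasDerivAt (fun y => val p x y) (val (dv p) x v) v := by
  induction p using MvPolynomial.induction_on with
  | C a => simpa [val, dv] using hasDerivAt_const v a
  | add p q hp hq =>
    simp only [val_add, dv, map_add] at *
    exact hp.add hq
  | mul_X p i hp =>
    have hX : HasDerivAt (fun y => val (MvPolynomial.X i) x y)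
        (val (MvPolynomial.pderiv 1 (MvPolynomial.X i)) x v) v := by
      fin_cases i
      · simpa [val, MvPolynomial.pderiv_X] using hasDerivAt_const v x
      · simpa [val, MvPolynomial.pderiv_X] using hasDerivAt_id' v
    have h := hp.mul hX
    simp only [dv, Derivation.leibniz, val_add, smul_eq_mul, val_mul] at *
    exact h.congr_deriv (by ring)

theorem dx_mem_restrictTotalDegree {k : ℕ} {p : Poly2}
    (hp : p ∈ MvPolynomial.restrictTotalDegree (Fin 2) ℝ k) :
    dx p ∈ MvPolynomial.restrictTotalDegree (Fin 2) ℝ k := by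
  rw [MvPolynomial.mem_restrictTotalDegree] at *
  rw [dx, p.as_sum, map_sum]
  refine MvPolynomial.totalDegree_finsetSum_le fun s hs => ?_
  rw [MvPolynomial.pderiv_monomial]
  refine (MvPolynomial.totalDegree_monomial_le _ _).trans (le_trans ?_ hp)
  refine le_trans ?_ (MvPolynomial.le_totalDegree hs)
  rw [Finsupp.sum_fintype _ _ fun _ => rfl, Finsupp.sum_fintype _ _ fun _ => rfl]
  exact Finset.sum_le_sum fun l _ => Nat.sub_le _ _

variable (N : ℕ)

theorem meshSize_pos [NeZero N] : 0 < meshSize N := by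
  have : (0 : ℝ) < N := Nat.cast_pos.mpr (NeZero.pos N)
  unfold meshSize
  positivity

theorem node_succ (m : ℕ) : node N (m + 1) = node N m + meshSize N := by
  unfold node; push_cast; ring

theorem node_lt_succ [NeZero N] (m : ℕ) : node N m < node N (m + 1) := by
  rw [node_succ]; linarith [meshSize_pos N]

theorem node_nonneg (m : ℕ) : 0 ≤ node N m := by
  unfold node meshSize; positivity

theorem cell_subset_closed_cell (i j : Fin N) : cell N i j ⊆
    Icc (node N i) (node N (i + 1)) ×ˢ Icc (node N j) (node N (j + 1)) :=
  prod_mono Ioo_subset_Icc_self Ioo_subset_Icc_self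

theorem integrableOn_cell {F : ℝ × ℝ → ℝ} (hF : Continuous F) (i j : Fin N) :
    IntegrableOn F (cell N i j) :=
  (hF.continuousOn.integrableOn_compact (isCompact_Icc.prod isCompact_Icc)).mono_set
    (cell_subset_closed_cell N i j)

theorem measurableSet_cell (i j : Fin N) : MeasurableSet (cell N i j) :=
  measurableSet_Ioo.prod measurableSet_Ioo

theorem isOpen_cell (i j : Fin N) : IsOpen (cell N i j) := isOpen_Ioo.prod isOpen_Ioo

/-- The integral over the element `(i, j)` as a functional on polynomials. -/
def cellInt (i j : Fin N) : Poly2 →ₗ[ℝ] ℝ where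
  toFun p := ∫ z in cell N i j, val p z.1 z.2
  map_add' p q := by
    simp only [val_add]
    exact integral_add (integrableOn_cell N (continuous_val p) i j)
      (integrableOn_cell N (continuous_val q) i j)
  map_smul' c p := by
    simp only [val_smul, RingHom.id_apply, smul_eq_mul]
    exact integral_const_mul _ _

/-- The integral over the segment `{x} × (v_j, v_{j+1})` as a functional on polynomials. -/
def vertInt (j : Fin N) (x : ℝ) : Poly2 →ₗ[ℝ] ℝ where
  toFun p := ∫ v in (node N j)..(node N (j + 1)), val p x v
  map_add' p q := by
    simp only [val_add]
    exact intervalIntegral.integral_add ((continuous_val_right p x).intervalIntegrable _ _)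
      ((continuous_val_right q x).intervalIntegrable _ _)
  map_smul' c p := by
    simp only [val_smul, RingHom.id_apply, smul_eq_mul]
    exact intervalIntegral.integral_const_mul _ _

/-- The integral over the segment `(x_i, x_{i+1}) × {v}` as a functional on polynomials. -/
def horizInt (i : Fin N) (v : ℝ) : Poly2 →ₗ[ℝ] ℝ where
  toFun p := ∫ x in (node N i)..(node N (i + 1)), val p x v
  map_add' p q := by
    simp only [val_add]
    exact intervalIntegral.integral_add ((continuous_val_left p v).intervalIntegrable _ _)
      ((continuous_val_left q v).intervalIntegrable _ _)
  map_smul' c p := by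
    simp only [val_smul, RingHom.id_apply, smul_eq_mul]
    exact intervalIntegral.integral_const_mul _ _

variable {N}

theorem cellInner_eq_cellInt (i j : Fin N) (p q : Poly2) :
    cellInner N i j (val p) (val q) = cellInt N i j (p * q) := by
  simp only [cellInner, cellInt, LinearMap.coe_mk, AddHom.coe_mk, val_mul]

theorem cellInt_mul_self_nonneg (i j : Fin N) (p : Poly2) : 0 ≤ cellInt N i j (p * p) :=
  integral_nonneg fun z => by simp only [val_mul]; exact mul_self_nonneg _

section Mesh

variable [NeZero N]

theorem eq_zero_of_cellInt_mul_self (i j : Fin N) (p : Poly2) (h : cellInt N i j (p * p) = 0) :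
    p = 0 := by
  have h' : ∫ z in cell N i j, val (p * p) z.1 z.2 = 0 := h
  rw [setIntegral_eq_zero_iff_of_nonneg_ae
    (Filter.Eventually.of_forall fun z => by simp only [val_mul]; exact mul_self_nonneg _)
    (integrableOn_cell N (continuous_val _) i j)] at h'
  have h2 := Measure.eqOn_open_of_ae_eq h' (isOpen_cell N i j) (continuous_val _).continuousOn
    continuousOn_const
  refine MvPolynomial.funext_set ![Ioo (node N i) (node N (i + 1)), Ioo (node N j) (node N (j + 1))]
    (fun l => ?_) (fun z hz => ?_)
  · fin_cases l
    · exact Ioo_infinite (node_lt_succ N i)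
    · exact Ioo_infinite (node_lt_succ N j)
  · have h3 := @h2 (z 0, z 1) ⟨hz 0 (mem_univ _), hz 1 (mem_univ _)⟩
    have h4 : val p (z 0) (z 1) = 0 := by simpa [val_mul] using h3
    have e : ![z 0, z 1] = z := by ext l; fin_cases l <;> rfl
    rw [val, e] at h4
    rw [h4, map_zero]

theorem cellInt_eq_integral_integral (i j : Fin N) (p : Poly2) :
    cellInt N i j p = ∫ x in (node N i)..(node N (i + 1)),
      ∫ v in (node N j)..(node N (j + 1)), val p x v := by
  have h := integrableOn_cell N (continuous_val p) i j
  rw [cell, Measure.volume_eq_prod] at h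
  simp only [cellInt, LinearMap.coe_mk, AddHom.coe_mk, cell, Measure.volume_eq_prod]
  rw [setIntegral_prod _ h, intervalIntegral.integral_of_le (node_lt_succ N i).le,
    integral_Ioc_eq_integral_Ioo]
  simp only [intervalIntegral.integral_of_le (node_lt_succ N j).le, integral_Ioc_eq_integral_Ioo]

theorem cellInt_eq_integral_integral_swap (i j : Fin N) (p : Poly2) :
    cellInt N i j p = ∫ v in (node N j)..(node N (j + 1)),
      ∫ x in (node N i)..(node N (i + 1)), val p x v := by
  have h := (integrableOn_cell N (continuous_val p) i j)
  rw [cell, Measure.volume_eq_prod] at h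
  have h' := h.swap
  simp only [cellInt, LinearMap.coe_mk, AddHom.coe_mk, cell, Measure.volume_eq_prod]
  rw [← setIntegral_prod_swap, show (fun z : ℝ × ℝ => val p z.swap.1 z.swap.2) =
      (fun z : ℝ × ℝ => val p z.1 z.2) ∘ Prod.swap from rfl, setIntegral_prod _ h',
    intervalIntegral.integral_of_le (node_lt_succ N j).le,
    integral_Ioc_eq_integral_Ioo]
  simp only [intervalIntegral.integral_of_le (node_lt_succ N i).le, integral_Ioc_eq_integral_Ioo,
    Prod.swap, Function.comp_def]

theorem cellInt_dx (i j : Fin N) (p : Poly2) :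
    cellInt N i j (dx p) = vertInt N j (node N (i + 1)) p - vertInt N j (node N i) p := by
  rw [cellInt_eq_integral_integral_swap]
  simp only [vertInt, LinearMap.coe_mk, AddHom.coe_mk]
  rw [← intervalIntegral.integral_sub ((continuous_val_right p _).intervalIntegrable _ _)
    ((continuous_val_right p _).intervalIntegrable _ _)]
  refine intervalIntegral.integral_congr fun v _ => ?_
  exact intervalIntegral.integral_eq_sub_of_hasDerivAt
    (fun x _ => hasDerivAt_val_left p x v) ((continuous_val_left _ v).intervalIntegrable _ _)

theorem cellInt_dv (i j : Fin N) (p : Poly2) :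
    cellInt N i j (dv p) = horizInt N i (node N (j + 1)) p - horizInt N i (node N j) p := by
  rw [cellInt_eq_integral_integral]
  simp only [horizInt, LinearMap.coe_mk, AddHom.coe_mk]
  rw [← intervalIntegral.integral_sub ((continuous_val_left p _).intervalIntegrable _ _)
    ((continuous_val_left p _).intervalIntegrable _ _)]
  refine intervalIntegral.integral_congr fun x _ => ?_
  exact intervalIntegral.integral_eq_sub_of_hasDerivAt
    (fun v _ => hasDerivAt_val_right p x v) ((continuous_val_right _ x).intervalIntegrable _ _)

theorem vertInt_mul_self_nonneg (j : Fin N) (x : ℝ) (p : Poly2) : 0 ≤ vertInt N j x (p * p) :=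
  intervalIntegral.integral_nonneg (node_lt_succ N j).le fun v _ => by
    rw [val_mul]; exact mul_self_nonneg _

/-- The velocity is nonnegative on `Ω`. -/
theorem vertInt_X_mul_mul_self_nonneg (j : Fin N) (x : ℝ) (p : Poly2) :
    0 ≤ vertInt N j x (MvPolynomial.X 1 * (p * p)) :=
  intervalIntegral.integral_nonneg (node_lt_succ N j).le fun v hv => by
    rw [val_mul, val_mul, val_X_one]
    exact mul_nonneg ((node_nonneg N j).trans hv.1) (mul_self_nonneg _)

theorem horizInt_mul_self_nonneg (i : Fin N) (v : ℝ) (p : Poly2) : 0 ≤ horizInt N i v (p * p) :=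
  intervalIntegral.integral_nonneg (node_lt_succ N i).le fun x _ => by
    rw [val_mul]; exact mul_self_nonneg _

end Mesh

/-- The trace inequality on the vertical edges of an element, obtained by integrating the one
dimensional inequality in `v`. -/
theorem exists_vertInt_trace_const (m : ℕ) : ∃ C : ℝ, 0 < C ∧ ∀ (N : ℕ) [NeZero N] (i j : Fin N)
    (p : Poly2), p.totalDegree ≤ m →
      meshSize N * vertInt N j (node N i) (p * p) ≤ C * cellInt N i j (p * p) ∧
      meshSize N * vertInt N j (node N (i + 1)) (p * p) ≤ C * cellInt N i j (p * p) := by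
  obtain ⟨C, hC, h⟩ := exists_trace_const m
  refine ⟨C, hC, fun N _ i j p hp => ?_⟩
  have hv : ∀ v : ℝ,
      meshSize N * val (p * p) (node N i) v
          ≤ C * ∫ x in (node N i)..(node N (i + 1)), val (p * p) x v ∧
      meshSize N * val (p * p) (node N (i + 1)) v
          ≤ C * ∫ x in (node N i)..(node N (i + 1)), val (p * p) x v := by
    intro v
    -- the restriction of `p` to a horizontal line
    let q : Polynomial ℝ := MvPolynomial.aeval ![Polynomial.X, Polynomial.C v] p
    have hq : q.natDegree ≤ m := by
      have := MvPolynomial.aeval_natDegree_le (n := 1) p hp ![Polynomial.X, Polynomial.C v]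
        (fun l => by fin_cases l <;> simp)
      rwa [mul_one] at this
    have hqv : ∀ x, q.eval x = val p x v := by
      intro x
      have e : (Polynomial.aeval x).comp
          (MvPolynomial.aeval ![Polynomial.X, Polynomial.C v] : Poly2 →ₐ[ℝ] Polynomial ℝ)
          = MvPolynomial.aeval ![x, v] := by
        ext l
        fin_cases l <;> simp
      have := DFunLike.congr_fun e p
      simpa [val, q, Polynomial.aeval_def, MvPolynomial.aeval_eq_eval] using this
    have := h q hq (node N i) (meshSize N) (meshSize_pos N)
    simp only [hqv, ← node_succ] at this
    simpa only [val_mul, sq] using this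
  have hcont : Continuous fun v => ∫ x in (node N i)..(node N (i + 1)), val (p * p) x v :=
    intervalIntegral.continuous_parametric_intervalIntegral_of_continuous'
      (f := fun v x => val (p * p) x v)
      (Continuous.comp (g := fun z : ℝ × ℝ => val (p * p) z.1 z.2) (f := Prod.swap)
        (continuous_val (p * p)) continuous_swap) _ _
  have hle := (node_lt_succ N j).le
  rw [cellInt_eq_integral_integral_swap]
  simp only [vertInt, LinearMap.coe_mk, AddHom.coe_mk]
  rw [← intervalIntegral.integral_const_mul, ← intervalIntegral.integral_const_mul,
    ← intervalIntegral.integral_const_mul]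
  constructor
  · exact intervalIntegral.integral_mono_on hle
      (((continuous_val_right _ _).const_mul _).intervalIntegrable _ _)
      ((hcont.const_mul _).intervalIntegrable _ _) fun v _ => (hv v).1
  · exact intervalIntegral.integral_mono_on hle
      (((continuous_val_right _ _).const_mul _).intervalIntegrable _ _)
      ((hcont.const_mul _).intervalIntegrable _ _) fun v _ => (hv v).2

/-- The `L²` projection onto `ℙ_k` on an element. -/
theorem exists_cell_projection [NeZero N] (k : ℕ) (i j : Fin N) (g : Poly2) :
    ∃ w : PolyLE k, ∀ q ∈ MvPolynomial.restrictTotalDegree (Fin 2) ℝ k,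
      cellInt N i j ((w : Poly2) * q) = cellInt N i j (g * q) := by
  obtain ⟨w, hw, h⟩ := exists_mem_forall_apply_mul_eq
    (MvPolynomial.restrictTotalDegree (Fin 2) ℝ k) (cellInt N i j)
    (fun p _ => cellInt_mul_self_nonneg i j p) (fun p _ => eq_zero_of_cellInt_mul_self i j p)
    ((cellInt N i j).comp (LinearMap.mulLeft ℝ g))
  exact ⟨⟨w, hw⟩, h⟩

/-! ### Neighbouring elements, projection errors and jump terms -/

/-- The sequence `f` shifted by one, `i ↦ f (i - 1)`, extended by zero. -/
def prev {N : ℕ} {M : Type*} [Zero M] (f : Fin N → M) (i : Fin N) : M :=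
  if h : i.1 = 0 then 0 else f ⟨i.1 - 1, by omega⟩

/-- The sequence `f` shifted by one, `i ↦ f (i + 1)`, extended by zero. -/
def next {N : ℕ} {M : Type*} [Zero M] (f : Fin N → M) (i : Fin N) : M :=
  if h : i.1 + 1 < N then f ⟨i.1 + 1, h⟩ else 0

theorem prev_sub {N : ℕ} {M : Type*} [AddGroup M] (f g : Fin N → M) (i : Fin N) :
    prev (fun l => f l - g l) i = prev f i - prev g i := by
  unfold prev; split_ifs <;> simp

theorem next_sub {N : ℕ} {M : Type*} [AddGroup M] (f g : Fin N → M) (i : Fin N) :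
    next (fun l => f l - g l) i = next f i - next g i := by
  unfold next; split_ifs <;> simp

theorem sum_prev {N : ℕ} (f : Fin (N + 1) → ℝ) :
    ∑ i, prev f i = ∑ i, f i - f (Fin.last N) := by
  rw [Fin.sum_univ_succ, Fin.sum_univ_castSucc (f := f)]
  have h0 : prev f 0 = 0 := by simp [prev]
  have h1 : ∀ i : Fin N, prev f i.succ = f i.castSucc := fun i => by
    simp [prev, Fin.castSucc, Fin.castAdd, Fin.castLE]
  simp only [h0, h1]
  ring

theorem sum_prev_le {N : ℕ} [NeZero N] {f : Fin N → ℝ} (hf : ∀ i, 0 ≤ f i) :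
    ∑ i, prev f i ≤ ∑ i, f i := by
  obtain ⟨M, rfl⟩ := Nat.exists_eq_succ_of_ne_zero (NeZero.ne N)
  rw [sum_prev]
  linarith [hf (Fin.last M)]

section Fluxes

variable {N k : ℕ}

theorem fluxGx_succ (G : FESpace N k) (i j : Fin N) (v : ℝ) :
    fluxGx G i.succ j v = val (G i j) (node N (i + 1)) v := by
  simp [fluxGx]

theorem fluxGv_succ (G : FESpace N k) (i j : Fin N) (x : ℝ) :
    fluxGv G i j.succ x = val (next (fun l => (G i l : Poly2)) j) x (node N (j + 1)) := by
  unfold fluxGv next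
  rw [if_neg (Fin.succ_ne_zero j)]
  by_cases h : j.1 + 1 < N
  · rw [dif_neg (fun h' => by have := congrArg Fin.val h'; simp at this; omega), dif_pos h]
    rfl
  · rw [dif_pos (Fin.ext (by simp; omega)), dif_neg h, val_zero]

/-- The squared `L²` norm on the finite element space. -/
def sqNorm (u : FESpace N k) : ℝ := ∑ i, ∑ j, cellInt N i j ((u i j : Poly2) * u i j)

theorem sqNorm_nonneg (u : FESpace N k) : 0 ≤ sqNorm u :=
  Finset.sum_nonneg fun i _ => Finset.sum_nonneg fun j _ => cellInt_mul_self_nonneg i j _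

/-- The projection error of `v E` is of order `h`, since `v` varies by `h` on an element: subtracting
from `v E` the polynomial `v_j E` of degree at most `k` does not change the error. -/
theorem cellInt_projection_error_le (i j : Fin N) {e w : Poly2}
    (he : e ∈ MvPolynomial.restrictTotalDegree (Fin 2) ℝ k)
    (hw : w ∈ MvPolynomial.restrictTotalDegree (Fin 2) ℝ k)
    (h : ∀ q ∈ MvPolynomial.restrictTotalDegree (Fin 2) ℝ k,
      cellInt N i j (w * q) = cellInt N i j (MvPolynomial.X 1 * e * q)) :
    cellInt N i j ((w - MvPolynomial.X 1 * e) * (w - MvPolynomial.X 1 * e)) ≤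
      meshSize N ^ 2 * cellInt N i j (e * e) := by
  set r : Poly2 := w - MvPolynomial.X 1 * e with hr
  set g : Poly2 := (MvPolynomial.X 1 - MvPolynomial.C (node N j)) * e with hg
  have hrg : r + g ∈ MvPolynomial.restrictTotalDegree (Fin 2) ℝ k := by
    have : r + g = w - node N j • e := by
      rw [hr, hg, MvPolynomial.smul_eq_C_mul]; ring
    rw [this]
    exact Submodule.sub_mem _ hw (Submodule.smul_mem _ _ he)
  have h1 : cellInt N i j (r * (r + g)) = 0 := by
    rw [hr, sub_mul, map_sub, h _ hrg, sub_self]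
  have h2 := cellInt_mul_self_nonneg i j (r + g)
  have e1 : (r + g) * (r + g) = (2 : ℝ) • (r * (r + g)) + g * g - r * r := by
    rw [MvPolynomial.smul_eq_C_mul, map_ofNat]; ring
  rw [e1, map_sub, map_add, map_smul, h1, smul_zero, zero_add] at h2
  have h3 : cellInt N i j (g * g) ≤ meshSize N ^ 2 * cellInt N i j (e * e) := by
    rw [← smul_eq_mul (meshSize N ^ 2), ← map_smul]
    simp only [cellInt, LinearMap.coe_mk, AddHom.coe_mk]
    refine setIntegral_mono_on (integrableOn_cell N (continuous_val _) i j)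
      (integrableOn_cell N (continuous_val _) i j) (measurableSet_cell N i j) fun z hz => ?_
    have hz2 : z.2 ∈ Ioo (node N j) (node N (j + 1)) := hz.2
    rw [node_succ] at hz2
    simp only [hg, val_smul, val_mul, val_sub, val_X_one, val_C]
    have : (z.2 - node N j) ^ 2 ≤ meshSize N ^ 2 :=
      pow_le_pow_left₀ (by linarith [hz2.1]) (by linarith [hz2.2]) 2
    nlinarith [mul_le_mul_of_nonneg_right this (mul_self_nonneg (val e z.1 z.2))]
  linarith

variable [NeZero N]

theorem fluxGx_castSucc (G : FESpace N k) (i j : Fin N) (v : ℝ) :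
    fluxGx G i.castSucc j v = val (prev (fun l => (G l j : Poly2)) i) (node N i) v := by
  unfold fluxGx prev
  by_cases h : i.1 = 0
  · rw [dif_pos (Fin.ext (by simpa using h)), dif_pos h, val_zero]
  · rw [dif_neg (fun h' => h (by simpa using congrArg Fin.val h')), dif_neg h]
    rfl

theorem fluxGv_castSucc (G : FESpace N k) (i j : Fin N) (x : ℝ) :
    fluxGv G i j.castSucc x = if j.1 = 0 then 0 else val (G i j) x (node N j) := by
  unfold fluxGv
  by_cases h : j.1 = 0
  · rw [if_pos (Fin.ext (by simpa using h)), if_pos h]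
  · rw [if_neg (fun h' => h (by simpa using congrArg Fin.val h')), if_neg h,
      dif_neg (fun h' => by have := congrArg Fin.val h'; simp at this; omega)]
    rfl

theorem fluxPv_succ (ϑ : ℝ) (G P : FESpace N k) (i j : Fin N) (x : ℝ) :
    fluxPv ϑ G P i j.succ x = val (P i j) x (node N (j + 1)) := by
  simp [fluxPv]

theorem fluxPv_castSucc (ϑ : ℝ) (G P : FESpace N k) (i j : Fin N) (x : ℝ) :
    fluxPv ϑ G P i j.castSucc x =
      if j.1 = 0 then val (P i j) x (node N j) + ϑ * val (G i j) x (node N j) / meshSize N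
      else val (prev (fun l => (P i l : Poly2)) j) x (node N j) := by
  unfold fluxPv prev
  by_cases h : j.1 = 0
  · have hj : j = 0 := Fin.ext (by simpa using h)
    subst hj
    rw [dif_pos (Fin.ext (by simp)), if_pos h]
    simp
  · rw [dif_neg (fun h' => h (by simpa using congrArg Fin.val h')), if_neg h, dif_neg h]
    rfl

/-- With the flux `P̂_v` the jump term of the evolution equation only sees the lower edge. -/
theorem jumpPv_eq (ϑ : ℝ) (G P μ : FESpace N k) (i j : Fin N) :
    jumpPv ϑ G P μ i j = horizInt N i (node N j)
      ((if j.1 = 0 then (ϑ / meshSize N) • (G i j : Poly2)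
        else prev (fun l => (P i l : Poly2)) j - P i j) * μ i j) := by
  simp only [jumpPv, horizInt, LinearMap.coe_mk, AddHom.coe_mk]
  refine intervalIntegral.integral_congr fun x _ => ?_
  simp only [fluxPv_succ, fluxPv_castSucc, val_mul]
  split_ifs
  · rw [val_smul]; ring
  · rw [val_sub]; ring

/-- The upwind flux `Ĝ` leaves a jump in `x` only on the left edge, and the flux in `v` one on the
upper edge, together with the boundary value at `v = 0`. -/
theorem jumpG_eq (G νx νv : FESpace N k) (i j : Fin N) :
    jumpG G νx νv i j =
      -vertInt N j (node N i) ((G i j - prev (fun l => (G l j : Poly2)) i) * νx i j)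
      + horizInt N i (node N (j + 1)) ((G i j - next (fun l => (G i l : Poly2)) j) * νv i j)
      - (if j.1 = 0 then horizInt N i (node N j) ((G i j : Poly2) * νv i j) else 0) := by
  have e1 : ∫ v in (node N j)..(node N (j + 1)),
      ((val (G i j) (node N (i + 1)) v - fluxGx G i.succ j v) * val (νx i j) (node N (i + 1)) v
      - (val (G i j) (node N i) v - fluxGx G i.castSucc j v) * val (νx i j) (node N i) v)
      = -vertInt N j (node N i) ((G i j - prev (fun l => (G l j : Poly2)) i) * νx i j) := by
    simp only [vertInt, LinearMap.coe_mk, AddHom.coe_mk, ← intervalIntegral.integral_neg]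
    refine intervalIntegral.integral_congr fun v _ => ?_
    simp only [fluxGx_succ, fluxGx_castSucc, val_mul, val_sub]
    ring
  have e2 : ∫ x in (node N i)..(node N (i + 1)),
      ((val (G i j) x (node N (j + 1)) - fluxGv G i j.succ x) * val (νv i j) x (node N (j + 1))
      - (val (G i j) x (node N j) - fluxGv G i j.castSucc x) * val (νv i j) x (node N j))
      = horizInt N i (node N (j + 1)) ((G i j - next (fun l => (G i l : Poly2)) j) * νv i j)
      - (if j.1 = 0 then horizInt N i (node N j) ((G i j : Poly2) * νv i j) else 0) := by
    simp only [horizInt, LinearMap.coe_mk, AddHom.coe_mk, fluxGv_succ, fluxGv_castSucc]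
    split_ifs
    · rw [← intervalIntegral.integral_sub ((continuous_val_left _ _).intervalIntegrable _ _)
        ((continuous_val_left _ _).intervalIntegrable _ _)]
      refine intervalIntegral.integral_congr fun x _ => ?_
      simp only [val_mul, val_sub]
      ring
    · rw [sub_zero]
      refine intervalIntegral.integral_congr fun x _ => ?_
      simp only [val_mul, val_sub]
      ring
  rw [jumpG, e1, e2]
  ring

theorem jumpG_sub (G G' νx νv : FESpace N k) (i j : Fin N) :
    jumpG (G - G') νx νv i j = jumpG G νx νv i j - jumpG G' νx νv i j := by
  simp only [jumpG_eq, Pi.sub_apply, Submodule.coe_sub, prev_sub, next_sub, sub_mul, map_sub]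
  split_ifs <;> ring

theorem jumpPv_sub (ϑ : ℝ) (G G' P P' μ : FESpace N k) (i j : Fin N) :
    jumpPv ϑ (G - G') (P - P') μ i j = jumpPv ϑ G P μ i j - jumpPv ϑ G' P' μ i j := by
  simp only [jumpPv_eq, Pi.sub_apply, Submodule.coe_sub, prev_sub]
  split_ifs
  · rw [smul_sub, sub_mul, map_sub]
  · simp only [sub_mul, map_sub]; ring

/-! ### Energy estimates at one time level -/

/-- The discrete diffusion term in `v` dominates `‖P_v‖²`: after integration by parts the alternating
fluxes cancel at the interior mesh lines, and the penalty is nonnegative. -/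
theorem sum_cellInt_mul_self_le_diffusion {ϑ : ℝ} (hϑ : 0 < ϑ) (E P : FESpace N k) (i : Fin N)
    (h : ∀ j, cellInt N i j ((P i j : Poly2) * P i j) =
      cellInt N i j (dv (E i j) * P i j) - jumpG E 0 P i j) :
    ∑ j, cellInt N i j ((P i j : Poly2) * P i j) ≤
      ∑ j, (jumpPv ϑ E P E i j - cellInt N i j (dv (P i j) * E i j)) := by
  set f : Fin N → ℝ := fun j =>
    horizInt N i (node N (j + 1)) (next (fun l => (E i l : Poly2)) j * P i j) with hf
  have hsum : ∑ j, prev f j = ∑ j, f j := by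
    obtain ⟨M, rfl⟩ := Nat.exists_eq_succ_of_ne_zero (NeZero.ne N)
    rw [sum_prev]
    simp [hf, next]
  have key : ∀ j, cellInt N i j ((P i j : Poly2) * P i j) - f j + prev f j ≤
      jumpPv ϑ E P E i j - cellInt N i j (dv (P i j) * E i j) := by
    intro j
    have hparts : cellInt N i j (dv (P i j) * E i j) + cellInt N i j (dv (E i j) * P i j)
        = horizInt N i (node N (j + 1)) ((P i j : Poly2) * E i j)
          - horizInt N i (node N j) ((P i j : Poly2) * E i j) := by
      rw [← cellInt_dv, ← map_add]
      congr 1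
      simp only [dv, Derivation.leibniz, smul_eq_mul]
      ring
    have hj := h j
    rw [jumpG_eq] at hj
    rw [jumpPv_eq]
    simp only [Pi.zero_apply, ZeroMemClass.coe_zero, mul_zero, map_zero, neg_zero, zero_add,
      sub_mul, map_sub] at hj
    have e1 := congrArg (horizInt N i (node N (j + 1))) (mul_comm (P i j : Poly2) (E i j))
    have e2 := congrArg (horizInt N i (node N j)) (mul_comm (P i j : Poly2) (E i j))
    by_cases h0 : j.1 = 0
    · rw [if_pos h0] at hj ⊢
      have hp : prev f j = 0 := by simp [prev, h0]
      rw [smul_mul_assoc, map_smul, smul_eq_mul, hp]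
      have : 0 ≤ ϑ / meshSize N * horizInt N i (node N j) ((E i j : Poly2) * E i j) :=
        mul_nonneg (div_pos hϑ (meshSize_pos N)).le (horizInt_mul_self_nonneg _ _ _)
      simp only [hf]
      linarith
    · rw [if_neg h0] at hj ⊢
      have hp : prev f j = horizInt N i (node N j) (prev (fun l => (P i l : Poly2)) j * E i j) := by
        have h1 : j.1 - 1 + 1 = j.1 := by omega
        simp only [prev, h0, dif_neg, not_false_eq_true, hf, next, h1, Fin.is_lt, dif_pos,
          Fin.eta]
        rw [mul_comm]
      rw [hp, sub_mul, map_sub]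
      simp only [hf]
      linarith
  calc ∑ j, cellInt N i j ((P i j : Poly2) * P i j)
      = ∑ j, (cellInt N i j ((P i j : Poly2) * P i j) - f j + prev f j) := by
        rw [Finset.sum_add_distrib, Finset.sum_sub_distrib, hsum]; ring
    _ ≤ _ := Finset.sum_le_sum fun j _ => key j

/-- The discrete transport term in `x` is bounded below by a multiple of `-‖E‖²`. If `v E` were an
admissible test function for the gradient, upwinding would make this term nonnegative; its
projection `w` produces in addition the jumps of `E` times the trace of `w - v E`, which are
absorbed by the trace inequality, of constant `C`. -/
theorem transport_lower_bound {C : ℝ} (hC : 0 < C)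
    (htr : ∀ (i j : Fin N) (p : Poly2), p.totalDegree ≤ k + 1 →
      meshSize N * vertInt N j (node N i) (p * p) ≤ C * cellInt N i j (p * p) ∧
      meshSize N * vertInt N j (node N (i + 1)) (p * p) ≤ C * cellInt N i j (p * p))
    (E Q : FESpace N k) (j : Fin N)
    (h : ∀ (ν : FESpace N k) (i : Fin N), cellInt N i j ((Q i j : Poly2) * ν i j) =
      cellInt N i j (dx (E i j) * ν i j) - jumpG E ν 0 i j) :
    -(5 / 2 * C) * ∑ i, cellInt N i j ((E i j : Poly2) * E i j) ≤
      ∑ i, cellInt N i j (MvPolynomial.X 1 * (Q i j : Poly2) * (E i j : Poly2)) := by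
  have hh := meshSize_pos N
  set q : Fin N → ℝ := fun i => cellInt N i j ((E i j : Poly2) * E i j) with hq
  set a : Fin N → ℝ := fun i =>
    vertInt N j (node N (i + 1)) (MvPolynomial.X 1 * ((E i j : Poly2) * (E i j : Poly2))) with ha
  have hdeg : ∀ i, (E i j : Poly2).totalDegree ≤ k := fun i =>
    (MvPolynomial.mem_restrictTotalDegree _ _ _).mp (E i j).2
  choose W hW using fun i => exists_cell_projection k i j (MvPolynomial.X 1 * (E i j : Poly2))
  have key : ∀ i, 1 / 2 * (a i - prev a i) - (3 / 2 * C * q i + C * prev q i) ≤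
      cellInt N i j (MvPolynomial.X 1 * (Q i j : Poly2) * (E i j : Poly2)) := by
    intro i
    set e : Poly2 := (E i j : Poly2) with he
    set F : Poly2 := prev (fun l => (E l j : Poly2)) i with hF
    set w : Poly2 := (W i : Poly2) with hw
    set r : Poly2 := w - MvPolynomial.X 1 * e with hr
    -- the gradient equation, tested with the projection of `v E`
    have h1 : cellInt N i j (MvPolynomial.X 1 * (Q i j : Poly2) * e) =
        cellInt N i j (dx e * (MvPolynomial.X 1 * e))
          + vertInt N j (node N i) ((e - F) * w) := by
      have h2 := h (fun i' _ => W i') i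
      rw [jumpG_eq] at h2
      simp only [Pi.zero_apply, ZeroMemClass.coe_zero, mul_zero, map_zero, ite_self, add_zero,
        sub_zero, sub_neg_eq_add] at h2
      have h3 := hW i (Q i j) (Q i j).2
      have h4 := hW i (dx e) (dx_mem_restrictTotalDegree (E i j).2)
      rw [mul_comm] at h3
      rw [mul_comm] at h4
      rw [h3, h4] at h2
      rw [show MvPolynomial.X 1 * (Q i j : Poly2) * e = MvPolynomial.X 1 * e * (Q i j : Poly2) by ring,
        h2,
        mul_comm (dx e)]
    have h5 : cellInt N i j (dx e * (MvPolynomial.X 1 * e)) =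
        1 / 2 * (a i - vertInt N j (node N i) (MvPolynomial.X 1 * (e * e))) := by
      simp only [ha]
      rw [← cellInt_dx, ← smul_eq_mul (1 / 2 : ℝ), ← map_smul]
      congr 1
      simp only [dx, Derivation.leibniz, smul_eq_mul, MvPolynomial.pderiv_X_of_ne
        (show (1 : Fin 2) ≠ 0 by decide), mul_zero, add_zero]
      rw [MvPolynomial.smul_eq_C_mul]
      have : (MvPolynomial.C (1 / 2 : ℝ) : Poly2) * 2 = 1 := by
        rw [← map_ofNat MvPolynomial.C 2, ← map_mul]; norm_num
      linear_combination (-(MvPolynomial.X 1 * e * (MvPolynomial.pderiv 0) e)) * this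
    have h6 : vertInt N j (node N i) ((e - F) * w) =
        1 / 2 * vertInt N j (node N i) (MvPolynomial.X 1 * (e * e))
        - 1 / 2 * vertInt N j (node N i) (MvPolynomial.X 1 * (F * F))
        + 1 / 2 * vertInt N j (node N i) (MvPolynomial.X 1 * ((e - F) * (e - F)))
        + vertInt N j (node N i) ((e - F) * r) := by
      simp only [← smul_eq_mul (1 / 2 : ℝ), ← map_smul, ← map_sub, ← map_add]
      congr 1
      simp only [MvPolynomial.smul_eq_C_mul]
      have : (MvPolynomial.C (1 / 2 : ℝ) : Poly2) * 2 = 1 := by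
        rw [← map_ofNat MvPolynomial.C 2, ← map_mul]; norm_num
      rw [hr]
      linear_combination (-(MvPolynomial.X 1 * (e * e - e * F))) * this
    have h7 : vertInt N j (node N i) (MvPolynomial.X 1 * (F * F)) = prev a i := by
      by_cases h0 : i.1 = 0
      · simp [hF, prev, h0]
      · have h1 : i.1 - 1 + 1 = i.1 := by omega
        simp only [hF, prev, h0, dif_neg, not_false_eq_true, ha, h1]
    have h8 : meshSize N * vertInt N j (node N i) (F * F) ≤ C * prev q i := by
      by_cases h0 : i.1 = 0
      · simp [hF, prev, h0]
      · have h1 : i.1 - 1 + 1 = i.1 := by omega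
        have := (htr ⟨i.1 - 1, by omega⟩ j _ ((hdeg ⟨i.1 - 1, by omega⟩).trans k.le_succ)).2
        simp only [h1] at this
        simpa only [hF, prev, h0, dif_neg, not_false_eq_true, hq] using this
    have h9 := (htr i j e ((hdeg i).trans k.le_succ)).1
    have h10 : meshSize N * vertInt N j (node N i) (r * r) ≤ C * (meshSize N ^ 2 * q i) := by
      have hrd : r.totalDegree ≤ k + 1 := by
        refine (MvPolynomial.totalDegree_sub _ _).trans (max_le ?_ ?_)
        · exact ((MvPolynomial.mem_restrictTotalDegree _ _ _).mp (W i).2).trans k.le_succ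
        · refine (MvPolynomial.totalDegree_mul _ _).trans ?_
          rw [MvPolynomial.totalDegree_X]
          exact (Nat.add_le_add_left (hdeg i) 1).trans (Nat.add_comm 1 k).le
      exact (htr i j r hrd).1.trans (mul_le_mul_of_nonneg_left
        (cellInt_projection_error_le i j (E i j).2 (W i).2 (hW i)) hC.le)
    -- Young's inequality, weighted by the mesh size
    have h11 := vertInt_mul_self_nonneg j (node N i) (meshSize N • (e - F) + r)
    have h12 := vertInt_mul_self_nonneg j (node N i) (e + F)
    have e11 : (meshSize N • (e - F) + r) * (meshSize N • (e - F) + r) =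
        (2 * meshSize N ^ 2) • (e * e) + (2 * meshSize N ^ 2) • (F * F)
        - (meshSize N ^ 2) • ((e + F) * (e + F)) + (2 * meshSize N) • ((e - F) * r) + r * r := by
      simp only [MvPolynomial.smul_eq_C_mul, map_mul, map_pow, map_ofNat]
      ring
    rw [e11] at h11
    simp only [map_add, map_sub, map_smul, smul_eq_mul] at h11
    have h13 := vertInt_X_mul_mul_self_nonneg j (node N i) (e - F)
    have h14 : -(3 / 2 * C * q i + C * prev q i) ≤ vertInt N j (node N i) ((e - F) * r) := by
      have h15 : 0 ≤ meshSize N ^ 2 *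
          (3 * C * q i + 2 * C * prev q i + 2 * vertInt N j (node N i) ((e - F) * r)) := by
        have hh2 := pow_pos hh 2
        have t1 := mul_nonneg hh.le h11
        have t2 := mul_le_mul_of_nonneg_left h8 hh2.le
        have t3 := mul_le_mul_of_nonneg_left h9 hh2.le
        have t4 := mul_nonneg (pow_pos hh 3).le h12
        have t5 : cellInt N i j (e * e) = q i := rfl
        rw [t5] at t3
        linarith
      linarith [nonneg_of_mul_nonneg_right h15 (pow_pos hh 2)]
    rw [h1, h5, h6, h7]
    linarith
  have hsa : ∑ i, prev a i ≤ ∑ i, a i :=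
    sum_prev_le fun i => vertInt_X_mul_mul_self_nonneg j _ _
  have hsq : ∑ i, prev q i ≤ ∑ i, q i := sum_prev_le fun i => cellInt_mul_self_nonneg i j _
  have hs := Finset.sum_le_sum fun i (_ : i ∈ Finset.univ) => key i
  refine le_trans ?_ hs
  rw [Finset.sum_sub_distrib, ← Finset.mul_sum, Finset.sum_sub_distrib, Finset.sum_add_distrib,
    ← Finset.mul_sum, ← Finset.mul_sum]
  nlinarith

end Fluxes

/-! ### The spatial lower bound on the whole mesh -/

theorem node_le_one {N m : ℕ} (h : m ≤ N) : node N m ≤ 1 := by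
  unfold node meshSize
  rw [mul_one_div]
  exact div_le_one_of_le₀ (Nat.cast_le.mpr h) (Nat.cast_nonneg N)

theorem cell_subset_domain {N : ℕ} (i j : Fin N) : cell N i j ⊆ domain :=
  prod_mono (Ioo_subset_Ioo (node_nonneg N i) (node_le_one i.2))
    (Ioo_subset_Ioo (node_nonneg N j) (node_le_one j.2))

section Energy

variable {N k : ℕ}

theorem neg_le_cellInt_X_mul (i j : Fin N) (p e : Poly2) :
    -(cellInt N i j (p * p) + 1 / 4 * cellInt N i j (e * e)) ≤
      -cellInt N i j (MvPolynomial.X 1 * p * e) := by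
  rw [neg_le_neg_iff, ← smul_eq_mul (1 / 4 : ℝ), ← map_smul, ← map_add]
  simp only [cellInt, LinearMap.coe_mk, AddHom.coe_mk]
  refine setIntegral_mono_on (integrableOn_cell N (continuous_val _) i j)
    (integrableOn_cell N (continuous_val _) i j) (measurableSet_cell N i j) fun z hz => ?_
  have hz2 : z.2 ∈ Ioo (0 : ℝ) 1 := (cell_subset_domain i j hz).2
  simp only [val_add, val_smul, val_mul, val_X_one]
  have h1 : z.2 ^ 2 ≤ 1 := pow_le_one₀ hz2.1.le hz2.2.le
  nlinarith [sq_nonneg (val p z.1 z.2 - 1 / 2 * (z.2 * val e z.1 z.2)),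
    mul_le_mul_of_nonneg_right h1 (sq_nonneg (val e z.1 z.2))]

/-- The spatial part of the scheme is bounded below by a multiple of `-‖E‖²` that depends only on
the polynomial degree. -/
theorem exists_spatial_lower_bound (k : ℕ) : ∃ K : ℝ, 0 < K ∧ ∀ (N : ℕ) [NeZero N] (ϑ : ℝ), 0 < ϑ →
    ∀ E Q P : FESpace N k,
      (∀ (νx νv : FESpace N k) (i j : Fin N),
        cellInt N i j ((Q i j : Poly2) * νx i j) + cellInt N i j ((P i j : Poly2) * νv i j) =
          cellInt N i j (dx (E i j) * νx i j) + cellInt N i j (dv (E i j) * νv i j)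
            - jumpG E νx νv i j) →
      -K * sqNorm E ≤ ∑ i, ∑ j, (cellInt N i j (MvPolynomial.X 1 * (Q i j : Poly2) * (E i j : Poly2))
        - cellInt N i j (MvPolynomial.X 1 * (P i j : Poly2) * (E i j : Poly2))
        - cellInt N i j (dv (P i j) * E i j) + jumpPv ϑ E P E i j) := by
  obtain ⟨C, hC, htr⟩ := exists_vertInt_trace_const (k + 1)
  refine ⟨5 / 2 * C + 1 / 4, by positivity, fun N _ ϑ hϑ E Q P h => ?_⟩
  have hx : -(5 / 2 * C) * sqNorm E ≤
      ∑ i, ∑ j, cellInt N i j (MvPolynomial.X 1 * (Q i j : Poly2) * (E i j : Poly2)) := by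
    rw [sqNorm, Finset.sum_comm, Finset.sum_comm (f := fun i j =>
      cellInt N i j (MvPolynomial.X 1 * (Q i j : Poly2) * (E i j : Poly2))), Finset.mul_sum]
    refine Finset.sum_le_sum fun j _ => transport_lower_bound hC (htr N) E Q j fun ν i => ?_
    simpa using h ν 0 i j
  have hv : ∑ i, ∑ j, cellInt N i j ((P i j : Poly2) * P i j) ≤
      ∑ i, ∑ j, (jumpPv ϑ E P E i j - cellInt N i j (dv (P i j) * E i j)) := by
    refine Finset.sum_le_sum fun i _ => sum_cellInt_mul_self_le_diffusion hϑ E P i fun j => ?_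
    simpa using h 0 P i j
  have hm : -(∑ i, ∑ j, cellInt N i j ((P i j : Poly2) * P i j) + 1 / 4 * sqNorm E) ≤
      ∑ i, ∑ j, -cellInt N i j (MvPolynomial.X 1 * (P i j : Poly2) * (E i j : Poly2)) := by
    simp only [sqNorm, Finset.mul_sum, ← Finset.sum_add_distrib, ← Finset.sum_neg_distrib]
    exact Finset.sum_le_sum fun i _ => Finset.sum_le_sum fun j _ => neg_le_cellInt_X_mul i j _ _
  calc -(5 / 2 * C + 1 / 4) * sqNorm E
      ≤ ∑ i, ∑ j, cellInt N i j (MvPolynomial.X 1 * (Q i j : Poly2) * (E i j : Poly2))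
        + ∑ i, ∑ j, -cellInt N i j (MvPolynomial.X 1 * (P i j : Poly2) * (E i j : Poly2))
        + ∑ i, ∑ j, (jumpPv ϑ E P E i j - cellInt N i j (dv (P i j) * E i j)) := by linarith
    _ = _ := by
      simp only [← Finset.sum_add_distrib]
      refine Finset.sum_congr rfl fun i _ => Finset.sum_congr rfl fun j _ => ?_
      ring

/-! ### The difference of two solutions -/

theorem cellInner_velocity_mul (i j : Fin N) (p q : Poly2) :
    cellInner N i j (fun x v => v * val p x v) (val q) =
      cellInt N i j (MvPolynomial.X 1 * p * q) := by
  rw [← cellInner_eq_cellInt]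
  congr 1
  funext x v
  rw [val_mul, val_X_one]

theorem cellInner_convolution (i j : Fin N) (n : ℕ) (d : ℕ → ℝ) (p : ℕ → Poly2) (q : Poly2) :
    cellInner N i j (fun x v => ∑ l ∈ Finset.range n, d l * (val (p (n - l)) x v - val (p 0) x v))
      (val q) = ∑ l ∈ Finset.range n, d l * cellInt N i j ((p (n - l) - p 0) * q) := by
  have e : (fun x v => ∑ l ∈ Finset.range n, d l * (val (p (n - l)) x v - val (p 0) x v))
      = val (∑ l ∈ Finset.range n, d l • (p (n - l) - p 0)) := by
    funext x v
    simp only [val, map_sum, MvPolynomial.smul_eval, map_sub]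
  rw [e, cellInner_eq_cellInt, Finset.sum_mul, map_sum]
  simp only [smul_mul_assoc, map_smul, smul_eq_mul]

/-- Testing with the new value: since the weights `d_l`, `l ≥ 1`, are nonpositive and their partial
sums nonnegative, twice the discrete fractional derivative tested with `u_n` dominates the discrete
fractional derivative of `‖u_n‖²`. -/
theorem sum_cqWeight_mul_sqNorm_le {α τ : ℝ} (hα : α ∈ Ioo (0 : ℝ) 1) (hτ : 0 < τ)
    (u : ℕ → FESpace N k) (n : ℕ) :
    ∑ l ∈ Finset.range n, cqWeight α τ l * (sqNorm (u (n - l)) - sqNorm (u 0)) ≤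
      2 * ∑ i, ∑ j, ∑ l ∈ Finset.range n, cqWeight α τ l *
        cellInt N i j (((u (n - l) i j : Poly2) - u 0 i j) * u n i j) := by
  -- polarization
  have hpol : ∀ l, 2 * ∑ i, ∑ j, cellInt N i j (((u (n - l) i j : Poly2) - u 0 i j) * u n i j) =
      sqNorm (u (n - l)) - sqNorm (u 0) - sqNorm (u (n - l) - u n) + sqNorm (u 0 - u n) := by
    intro l
    simp only [sqNorm, Finset.mul_sum, ← Finset.sum_sub_distrib, ← Finset.sum_add_distrib]
    refine Finset.sum_congr rfl fun i _ => Finset.sum_congr rfl fun j _ => ?_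
    rw [← smul_eq_mul (2 : ℝ), ← map_smul, ← map_sub, ← map_sub, ← map_add]
    congr 1
    simp only [Pi.sub_apply, Submodule.coe_sub, MvPolynomial.smul_eq_C_mul, map_ofNat]
    ring
  have hswap : 2 * ∑ i, ∑ j, ∑ l ∈ Finset.range n, cqWeight α τ l *
        cellInt N i j (((u (n - l) i j : Poly2) - u 0 i j) * u n i j) =
      ∑ l ∈ Finset.range n, cqWeight α τ l * (sqNorm (u (n - l)) - sqNorm (u 0)
        - sqNorm (u (n - l) - u n) + sqNorm (u 0 - u n)) := by
    rw [Finset.sum_congr rfl fun i _ => Finset.sum_comm, Finset.sum_comm, Finset.mul_sum]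
    refine Finset.sum_congr rfl fun l _ => ?_
    rw [← hpol]
    simp only [← Finset.mul_sum]
    ring
  have h1 : 0 ≤ ∑ l ∈ Finset.range n, cqWeight α τ l * -sqNorm (u (n - l) - u n) := by
    refine Finset.sum_nonneg fun l _ => ?_
    cases l with
    | zero => simp [sqNorm]
    | succ l =>
      exact mul_nonneg_of_nonpos_of_nonpos (cqWeight_succ_nonpos hα hτ l)
        (neg_nonpos.mpr (sqNorm_nonneg _))
  have h2 := mul_nonneg (sum_cqWeight_nonneg hα hτ n) (sqNorm_nonneg (u 0 - u n))
  rw [Finset.sum_mul] at h2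
  rw [hswap]
  have e : ∑ l ∈ Finset.range n, cqWeight α τ l * (sqNorm (u (n - l)) - sqNorm (u 0)
        - sqNorm (u (n - l) - u n) + sqNorm (u 0 - u n)) =
      ∑ l ∈ Finset.range n, cqWeight α τ l * (sqNorm (u (n - l)) - sqNorm (u 0))
      + ∑ l ∈ Finset.range n, cqWeight α τ l * -sqNorm (u (n - l) - u n)
      + ∑ l ∈ Finset.range n, cqWeight α τ l * sqNorm (u 0 - u n) := by
    simp only [← Finset.sum_add_distrib]
    exact Finset.sum_congr rfl fun l _ => by ring
  rw [e]
  linarith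

variable [NeZero N] {α τ ϑ : ℝ} {L : ℕ} {f : ℝ → ℝ × ℝ → ℝ} {G₀ G₀' : ℝ × ℝ → ℝ}
  {G Px Pv G' Px' Pv' : ℕ → FESpace N k}

theorem IsSolution.evolution_sub (S : IsSolution α τ ϑ L f G₀ G Px Pv)
    (S' : IsSolution α τ ϑ L f G₀' G' Px' Pv') {n : ℕ} (hn : 1 ≤ n) (hnL : n ≤ L)
    (μ : FESpace N k) (i j : Fin N) :
    ∑ l ∈ Finset.range n, cqWeight α τ l *
        cellInt N i j ((((G - G') (n - l) i j : Poly2) - (G - G') 0 i j) * μ i j)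
      + (cellInt N i j (MvPolynomial.X 1 * ((Px n - Px' n) i j : Poly2) * (μ i j : Poly2))
        - cellInt N i j (MvPolynomial.X 1 * ((Pv n - Pv' n) i j : Poly2) * (μ i j : Poly2))
        - cellInt N i j (dv ((Pv n - Pv' n) i j) * μ i j)
        + jumpPv ϑ (G n - G' n) (Pv n - Pv' n) μ i j)
      = cellInt N i j (((G n - G' n) i j : Poly2) * μ i j) := by
  have h := S.evolution n hn hnL μ i j
  have h' := S'.evolution n hn hnL μ i j
  rw [cellInner_convolution i j n (cqWeight α τ) (fun m => (G m i j : Poly2)),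
    cellInner_velocity_mul, cellInner_velocity_mul, cellInner_eq_cellInt,
    cellInner_eq_cellInt] at h
  rw [cellInner_convolution i j n (cqWeight α τ) (fun m => (G' m i j : Poly2)),
    cellInner_velocity_mul, cellInner_velocity_mul, cellInner_eq_cellInt,
    cellInner_eq_cellInt] at h'
  have e : ∑ l ∈ Finset.range n, cqWeight α τ l *
        cellInt N i j ((((G - G') (n - l) i j : Poly2) - (G - G') 0 i j) * μ i j) =
      ∑ l ∈ Finset.range n, cqWeight α τ l *
        cellInt N i j (((G (n - l) i j : Poly2) - G 0 i j) * μ i j)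
      - ∑ l ∈ Finset.range n, cqWeight α τ l *
        cellInt N i j (((G' (n - l) i j : Poly2) - G' 0 i j) * μ i j) := by
    rw [← Finset.sum_sub_distrib]
    refine Finset.sum_congr rfl fun l _ => ?_
    rw [← mul_sub, ← map_sub]
    congr 2
    simp only [Pi.sub_apply, Submodule.coe_sub]
    ring
  rw [e, jumpPv_sub]
  simp only [Pi.sub_apply, Submodule.coe_sub, dv, mul_sub, sub_mul, map_sub] at *
  linarith

theorem IsSolution.gradient_sub (S : IsSolution α τ ϑ L f G₀ G Px Pv)
    (S' : IsSolution α τ ϑ L f G₀' G' Px' Pv') {n : ℕ} (hn : 1 ≤ n) (hnL : n ≤ L)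
    (νx νv : FESpace N k) (i j : Fin N) :
    cellInt N i j (((Px n - Px' n) i j : Poly2) * νx i j)
        + cellInt N i j (((Pv n - Pv' n) i j : Poly2) * νv i j) =
      cellInt N i j (dx ((G n - G' n) i j) * νx i j) + cellInt N i j (dv ((G n - G' n) i j) * νv i j)
        - jumpG (G n - G' n) νx νv i j := by
  have h := S.gradient n hn hnL νx νv i j
  have h' := S'.gradient n hn hnL νx νv i j
  simp only [cellInner_eq_cellInt] at h h'
  rw [jumpG_sub]
  simp only [Pi.sub_apply, Submodule.coe_sub, dv, dx, sub_mul, map_sub] at *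
  linarith

end Energy

/-! ### The `L²` norm of a finite element function -/

section Norm

variable {N k : ℕ}

theorem index_le_of_mem {i i' : Fin N} {x : ℝ} (h : x ∈ Ioo (node N i) (node N (i + 1)))
    (h' : x ∈ Ioo (node N i') (node N (i' + 1))) : i ≤ i' := by
  by_contra hlt
  have h1 : node N (i' + 1) ≤ node N i := by
    have h2 : ((i' : ℕ) : ℝ) + 1 ≤ (i : ℕ) := by exact_mod_cast not_le.mp hlt
    unfold node meshSize
    push_cast
    exact mul_le_mul_of_nonneg_right h2 (by positivity)
  linarith [h.1, h'.2]

theorem sum_indicator_cell (F : Fin N → Fin N → ℝ × ℝ → ℝ) {i j : Fin N} {z : ℝ × ℝ}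
    (hz : z ∈ cell N i j) : ∑ i', ∑ j', (cell N i' j').indicator (F i' j') z = F i j z := by
  have huniq : ∀ i' j', z ∈ cell N i' j' → i' = i ∧ j' = j := fun i' j' hz' =>
    ⟨le_antisymm (index_le_of_mem hz'.1 hz.1) (index_le_of_mem hz.1 hz'.1),
      le_antisymm (index_le_of_mem hz'.2 hz.2) (index_le_of_mem hz.2 hz'.2)⟩
  rw [Finset.sum_eq_single i, Finset.sum_eq_single j, indicator_of_mem hz]
  · exact fun j' _ hj' => indicator_of_notMem (fun h => hj' (huniq i j' h).2) _
  · simp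
  · exact fun i' _ hi' => Finset.sum_eq_zero fun j' _ =>
      indicator_of_notMem (fun h => hi' (huniq i' j' h).1) _
  · simp

theorem toFun_sq (u : FESpace N k) (z : ℝ × ℝ) : toFun u z ^ 2 =
    ∑ i, ∑ j, (cell N i j).indicator (fun w => val ((u i j : Poly2) * u i j) w.1 w.2) z := by
  by_cases hz : ∃ i j, z ∈ cell N i j
  · obtain ⟨i, j, hz⟩ := hz
    rw [toFun, sum_indicator_cell _ hz, sum_indicator_cell _ hz, val_mul, sq]
  · push Not at hz
    simp [toFun, indicator_of_notMem (hz _ _)]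

theorem measurable_toFun (u : FESpace N k) : Measurable (toFun u) :=
  Finset.measurable_fun_sum _ fun i _ => Finset.measurable_fun_sum _ fun j _ =>
    (continuous_val _).measurable.indicator (measurableSet_cell N i j)

theorem normL2_toFun (u : FESpace N k) :
    normL2 (toFun u) = ENNReal.ofReal (Real.sqrt (sqNorm u)) := by
  have hint : ∀ i j : Fin N, Integrable
      ((cell N i j).indicator fun w : ℝ × ℝ => val ((u i j : Poly2) * u i j) w.1 w.2)
      (volume.restrict domain) := fun i j =>
    ((integrable_indicator_iff (measurableSet_cell N i j)).mpr
      (integrableOn_cell N (continuous_val _) i j)).restrict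
  have hsq : (fun z => toFun u z ^ 2) = fun z =>
      ∑ i, ∑ j, (cell N i j).indicator (fun w => val ((u i j : Poly2) * u i j) w.1 w.2) z :=
    funext (toFun_sq u)
  have hmem : MemLp (toFun u) 2 (volume.restrict domain) := by
    rw [memLp_two_iff_integrable_sq (measurable_toFun u).aestronglyMeasurable, hsq]
    exact integrable_finsetSum _ fun i _ => integrable_finsetSum _ fun j _ => hint i j
  have hval : ∫ z in domain, toFun u z ^ 2 = sqNorm u := by
    rw [hsq, integral_finsetSum _ fun i _ => integrable_finsetSum _ fun j _ => hint i j]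
    refine Finset.sum_congr rfl fun i _ => ?_
    rw [integral_finsetSum _ fun j _ => hint i j]
    refine Finset.sum_congr rfl fun j _ => ?_
    rw [integral_indicator (measurableSet_cell N i j),
      Measure.restrict_restrict (measurableSet_cell N i j),
      inter_eq_left.mpr (cell_subset_domain i j)]
    rfl
  rw [normL2, hmem.eLpNorm_eq_integral_rpow_norm two_ne_zero ENNReal.ofNat_ne_top]
  simp only [ENNReal.toReal_ofNat, Real.rpow_two, Real.norm_eq_abs, sq_abs]
  rw [hval, Real.sqrt_eq_rpow, one_div]

end Norm

end KleinKramersLDG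

end

theorem theorem4p1 (α : ℝ) (hα : α ∈ Set.Ioo (0 : ℝ) 1) (k : ℕ) (hk : 1 ≤ k)
    (ϑ : ℝ) (hϑ : 0 < ϑ) :
    ∃ τ₀ : ℝ, 0 < τ₀ ∧ ∀ T : ℝ, 0 < T → ∃ C : ℝ, 0 < C ∧
      ∀ (N : ℕ) [NeZero N] (L : ℕ), 1 ≤ L → T / L ≤ τ₀ →
      ∀ f : ℝ → ℝ × ℝ → ℝ, (∀ t ∈ Set.Icc 0 T, KleinKramersLDG.InL2 (f t)) →
      ∀ G₀ G₀' : ℝ × ℝ → ℝ, KleinKramersLDG.InL2 G₀ → KleinKramersLDG.InL2 G₀' →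
      ∀ G Px Pv G' Px' Pv' : ℕ → KleinKramersLDG.FESpace N k,
        KleinKramersLDG.IsSolution α (T / L) ϑ L f G₀ G Px Pv →
        KleinKramersLDG.IsSolution α (T / L) ϑ L f G₀' G' Px' Pv' →
        ∀ n : ℕ, n ≤ L →
          KleinKramersLDG.normL2 (KleinKramersLDG.toFun (G n - G' n)) ≤
            ENNReal.ofReal C * KleinKramersLDG.normL2 (KleinKramersLDG.toFun (G 0 - G' 0)) := by
  open KleinKramersLDG in
  obtain ⟨K, hK, hlow⟩ := exists_spatial_lower_bound k
  -- `λ` is chosen such that `λ ^ α = 2 * (2 * (K + 1))`, as the Gronwall inequality requires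
  set lam : ℝ := (2 * (2 * (K + 1))) ^ α⁻¹ with hlam
  have hlam0 : 0 < lam := Real.rpow_pos_of_pos (by positivity) _
  have hlamα : lam ^ α = 2 * (2 * (K + 1)) := Real.rpow_inv_rpow (by positivity) hα.1.ne'
  refine ⟨1 / (2 * lam), by positivity, fun T hT =>
    ⟨Real.sqrt (1 + Real.exp (2 * (lam * T))), by positivity, ?_⟩⟩
  intro N _ L hL hτ₀ f _ G₀ G₀' _ _ G Px Pv G' Px' Pv' S S' n hn
  have hL0 : (0 : ℝ) < L := by exact_mod_cast hL
  have hτ : 0 < T / L := by positivity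
  have hs : lam * (T / L) ≤ 1 / 2 := by
    calc lam * (T / L) ≤ lam * (1 / (2 * lam)) := mul_le_mul_of_nonneg_left hτ₀ hlam0.le
      _ = 1 / 2 := by field_simp
  have hstep : ∀ n, 1 ≤ n → n ≤ L → ∑ l ∈ Finset.range n, cqWeight α (T / L) l *
      (sqNorm ((G - G') (n - l)) - sqNorm ((G - G') 0)) ≤
        2 * (K + 1) * sqNorm ((G - G') n) := by
    intro n hn1 hnL
    have h1 := sum_cqWeight_mul_sqNorm_le hα hτ (G - G') n
    have h2 := hlow N ϑ hϑ (G n - G' n) (Px n - Px' n) (Pv n - Pv' n)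
      (S.gradient_sub S' hn1 hnL)
    have h3 := Finset.sum_congr (s₁ := Finset.univ) rfl fun i _ =>
      Finset.sum_congr (s₁ := Finset.univ) rfl fun j _ =>
        S.evolution_sub S' hn1 hnL (G n - G' n) i j
    simp only [Finset.sum_add_distrib] at h3 h2
    change _ = sqNorm (G n - G' n) at h3
    change _ ≤ 2 * (K + 1) * sqNorm (G n - G' n)
    change _ ≤ 2 * ∑ i, ∑ j, ∑ l ∈ Finset.range n, cqWeight α (T / L) l *
        cellInt N i j ((((G - G') (n - l) i j : Poly2) - (G - G') 0 i j) * (G n - G' n) i j) at h1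
    linarith
  have h := cq_gronwall hα hτ hlam0 hlamα hs (A := fun m => sqNorm ((G - G') m))
    (sqNorm_nonneg _) hstep n hn
  have hexp : ((1 - lam * (T / L))⁻¹) ^ n ≤ Real.exp (2 * (lam * T)) := by
    refine (inv_one_sub_pow_le_exp (by positivity) hs n).trans (Real.exp_le_exp.mpr ?_)
    have h1 : (n : ℝ) * (T / L) ≤ T := by
      calc (n : ℝ) * (T / L) ≤ L * (T / L) :=
            mul_le_mul_of_nonneg_right (Nat.cast_le.mpr hn) hτ.le
        _ = T := by field_simp
    nlinarith [mul_le_mul_of_nonneg_left h1 hlam0.le]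
  rw [normL2_toFun, normL2_toFun, ← ENNReal.ofReal_mul (Real.sqrt_nonneg _),
    ← Real.sqrt_mul (by positivity)]
  refine ENNReal.ofReal_le_ofReal (Real.sqrt_le_sqrt (h.trans ?_))
  exact mul_le_mul_of_nonneg_right (by linarith) (sqNorm_nonneg _)
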